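/- Let $m\ge 2$, let $a\in[1,2)$, let $H_2,\dots,H_m\in\mathbb C$ be pairwise distinct, and let $q_2,\dots,q_m\in L_2(0,1)$ be complex-valued with $q_j=0$ a.e. on $(0,a-1)$. Consider a star graph with $m$ edges $e_1,\dots,e_m$ of length $1$: the edge $e_1$ joins the root ($x=0$) to the internal vertex ($x=1$), and each $e_j$, $j\ge2$, joins the internal vertex ($x=0$) to a non-root boundary vertex ($x=1$). For $\nu\in\{0,1\}$ let $\mathcal B_\nu(q,H)$ be the eigenvalue problem with global delay $a$ $$-y_1''(x)=\lambda y_1(x),\qquad -y_j''(x)+q_j(x)\,y_j(x-a)=\lambda y_j(x),\qquad 0<x<1,\ j=2,\dots,m,$$ $$y_j(x-a)=y_1(x-a+1),\qquad a-1<x<1,\ j=2,\dots,m,$$ $$y_1(1)=y_j(0),\ j=2,\dots,m,\qquad y_1'(1)=\sum_{j=2}^m y_j'(0),$$ $$y_1^{(\nu)}(0)=0,\qquad y_j'(1)+H_jy_j(1)=0,\ j=2,\dots,m,$$ where each $y_j$ has an absolutely continuous derivative on $[0,1]$ and the equations hold a.e. (on $(0,a-1)$ the term $q_j(x)y_j(x-a)$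 is zero). Let $\{\lambda_{n,\nu}\}_{n\in\mathbb N}$ be its spectrum, every eigenvalue being counted with its algebraic multiplicity, i.e. the dimension of the space of its root functions (eigenfunctions and associated functions). Theorem 1. Let $a$ and the pairwise distinct coefficients $H_2,\dots,H_m$ be known. Then the two spectra $\{\lambda_{n,0}\}_{n\in\mathbb N}$ and $\{\lambda_{n,1}\}_{n\in\mathbb N}$ uniquely determine $q_2,\dots,q_m$: if $q=[q_2,\dots,q_m]$ and $\tilde q=[\tilde q_2,\dots,\tilde q_m]$ are as above and, for both $\nu=0$ and $\nu=1$, the problems $\mathcal B_\nu(q,H)$ and $\mathcal B_\nu(\tilde q,H)$ have the same spectrum counted with multiplicities, then $q_j=\tilde q_j$ a.e. on $(0,1)$ for all $j=2,\dots,m$. -/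

import Mathlib

open MeasureTheory Set

noncomputable section

namespace StarDelay

/-- A function on the star graph with `m = n + 1` unit edges: edge `0` joins the root (at `0`) to
the internal vertex (at `1`), the edge `j.succ` joins the internal vertex (at `0`) to a non-root
boundary vertex (at `1`). A function on an edge `[0, 1]` is represented by its extension by zero
to `ℝ`, see `InDomain.eq_zero`. -/
abbrev GraphFun (n : ℕ) : Type := Fin (n + 1) → ℝ → ℂ

/-- The derivative of a function on the edge `[0, 1]`, one-sided at the end points. -/
def edgeDeriv (f : ℝ → ℂ) : ℝ → ℂ := derivWithin f (Icc 0 1)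

/-- The value `y_j (x - a)`, where the delay propagates through the internal vertex: on a non-root
edge it is `y_j (x - a)` for `a ≤ x` and `y_0 (x - a + 1)` for `x < a`. -/
def delayed {n : ℕ} (a : ℝ) (y : GraphFun n) (j : Fin (n + 1)) (x : ℝ) : ℂ :=
  if j ≠ 0 ∧ x < a then y 0 (x - a + 1) else y j (x - a)

/-- The differential expression `- y_j'' (x) + q_j (x) y_j (x - a)`. -/
def diffExpr {n : ℕ} (a : ℝ) (q y : GraphFun n) (j : Fin (n + 1)) (x : ℝ) : ℂ :=
  - edgeDeriv (edgeDeriv (y j)) x + q j x * delayed a y j x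

/-- The condition at the root: `y_0 (0) = 0` for `ν = 0` and `y_0' (0) = 0` for `ν = 1`. -/
def rootCondition {n : ℕ} (ν : Fin 2) (y : GraphFun n) : Prop :=
  if ν = 0 then y 0 0 = 0 else edgeDeriv (y 0) 0 = 0

/-- The domain of the operator: functions that are, on every edge, differentiable with an
absolutely continuous derivative, and that satisfy the standard matching conditions at the internal
vertex, the condition number `ν` at the root and the Robin conditions at the other boundary
vertices. -/
structure InDomain {n : ℕ} (H : Fin n → ℂ) (ν : Fin 2) (y : GraphFun n) : Prop where
  eq_zero : ∀ j, ∀ x ∉ Icc (0 : ℝ) 1, y j x = 0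
  differentiable : ∀ j, DifferentiableOn ℝ (y j) (Icc 0 1)
  absCont : ∀ j, AbsolutelyContinuousOnInterval (edgeDeriv (y j)) 0 1
  matching : ∀ j : Fin n, y 0 1 = y j.succ 0
  kirchhoff : edgeDeriv (y 0) 1 = ∑ j : Fin n, edgeDeriv (y j.succ) 0
  root : rootCondition ν y
  robin : ∀ j : Fin n, edgeDeriv (y j.succ) 1 + H j * y j.succ 1 = 0

/-- `y` is a root function (an eigenfunction or an associated function) of order at most `k` at
`μ`, that is, an element of the kernel of the `k`-th power of `L - μ`, where `L` is the operator
`y ↦ (- y_j'' + q_j y_j (· - a))_j` with the domain above. -/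
def IsRootFun {n : ℕ} (a : ℝ) (q : GraphFun n) (H : Fin n → ℂ) (ν : Fin 2) (μ : ℂ) :
    ℕ → GraphFun n → Prop
  | 0, y => y = 0
  | k + 1, y => InDomain H ν y ∧ ∃ z : GraphFun n, IsRootFun a q H ν μ k z ∧
      ∀ j, ∀ᵐ x ∂(volume.restrict (Ioo (0 : ℝ) 1)), diffExpr a q y j x - μ * y j x = z j x

/-- The space spanned by all root functions at `μ`. -/
def rootSpace {n : ℕ} (a : ℝ) (q : GraphFun n) (H : Fin n → ℂ) (ν : Fin 2) (μ : ℂ) :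
    Submodule ℂ (GraphFun n) :=
  Submodule.span ℂ {y | ∃ k, IsRootFun a q H ν μ k y}

/-- The algebraic multiplicity of `μ` as an eigenvalue (zero when `μ` is not an eigenvalue). As a
function of `μ`, it is the spectrum counted with multiplicities. -/
def algMultiplicity {n : ℕ} (a : ℝ) (q : GraphFun n) (H : Fin n → ℂ) (ν : Fin 2) (μ : ℂ) :
    Cardinal :=
  Module.rank ℂ (rootSpace a q H ν μ)

/-- Square-integrable complex potentials on the edges, vanishing on the parts of the edges on which
the delayed argument leaves the graph. -/
structure Admissible {n : ℕ} (a : ℝ) (q : GraphFun n) : Prop where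
  memLp : ∀ j, MemLp (q j) 2 (volume.restrict (Ioo (0 : ℝ) 1))
  root_edge : ∀ᵐ x ∂(volume.restrict (Ioo (0 : ℝ) (min a 1))), q 0 x = 0
  other_edges : ∀ j : Fin n, ∀ᵐ x ∂(volume.restrict (Ioo (0 : ℝ) (max 0 (a - 1)))),
    q j.succ x = 0

end StarDelay

end

/-! Because `1 ≤ a`, the delayed argument on every non-root edge falls in the root edge, so the
system is triangular: with `λ = ρ²`, the root edge carries a multiple of the free solution `phi ν
ρ`, which enters the equation on edge `j` only as the source `q_j(x) phi(x - a + 1)`. Green's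
formula expresses each Robin condition through `y_j(0)`, `y_j'(0)` and the integral `potInt`.
Eliminating the `y_j'(0)` by Kirchhoff's condition gives a characteristic function `charFn` that is
entire in `ρ` and affine in `q`.

Spectrum to `charFn`. The values `psi (H k) ρ 1` for distinct `H k` never vanish together, so at
each point at most one of them is zero. Dropping the Robin condition on that edge leaves a
one-dimensional kernel and one infinite Jordan chain. The first chain element violating the dropped
condition has an index equal both to the algebraic multiplicity and to the order of `charFn` in `ρ²
- ρ₀²` (`exists_algMultiplicity_eq_and_isTheta`). Two problems with the same spectrum therefore have
characteristic functions with an entire quotient. The potentials contribute at a lower order than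
the free part, so a maximum principle on rectangles and Liouville's theorem make the functions equal
(`charFn_eq_of_isBigO`).

`charFn` to `q`. The difference of the two functions is a sum over `j` of `potInt` differences times
the product of the other `psi (H k)`. At a zero of `psi (H j)` only the `j`-th term lacks that
factor, so the `j`-th difference is divisible by `psi (H j)`, for both `ν` (`potInt_sub_isBigO`).
The combination of the cases `ν = 1` and `ν = 0` replaces `phi` by an exponential that decays along
the positive imaginary axis, and the Liouville argument makes it vanish identically
(`potInt_add_mul_potInt_eq_zero`). Writing `psi` in exponentials then gives first the mean of the
difference of potentials and next all its Fourier coefficients as zero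
(`ae_eq_zero_of_potInt_isBigO`). -/

noncomputable section

namespace StarDelay

open Filter Topology Asymptotics

/-! ### Trigonometric solutions -/

/-- The solution `sin (ρ x) / ρ` of `y'' + ρ² y = 0`, equal to `x` for `ρ = 0`. -/
def sinq (ρ : ℂ) (x : ℝ) : ℂ := x * dslope Complex.sin 0 (ρ * x)

/-- The solution `cos (ρ x)` of `y'' + ρ² y = 0`. -/
def cosq (ρ : ℂ) (x : ℝ) : ℂ := Complex.cos (ρ * x)

lemma mul_sinq (ρ : ℂ) (x : ℝ) : ρ * sinq ρ x = Complex.sin (ρ * x) := by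
  have h := sub_smul_dslope Complex.sin 0 (ρ * x)
  simp only [sub_zero, smul_eq_mul, Complex.sin_zero] at h
  rw [sinq, ← h]; ring

lemma sinq_zero_left (x : ℝ) : sinq 0 x = x := by simp [sinq]

lemma sinq_eq_div {ρ : ℂ} (hρ : ρ ≠ 0) (x : ℝ) : sinq ρ x = Complex.sin (ρ * x) / ρ := by
  rw [← mul_sinq]; field_simp

lemma sinq_zero (ρ : ℂ) : sinq ρ 0 = 0 := by simp [sinq]

lemma cosq_zero (ρ : ℂ) : cosq ρ 0 = 1 := by simp [cosq]

lemma cosq_sq_add (ρ : ℂ) (x : ℝ) : cosq ρ x ^ 2 + ρ ^ 2 * sinq ρ x ^ 2 = 1 := by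
  rw [← mul_pow, mul_sinq, cosq]; exact Complex.cos_sq_add_sin_sq _

lemma hasDerivAt_sinq (ρ : ℂ) (x : ℝ) : HasDerivAt (sinq ρ) (cosq ρ x) x := by
  have hid : HasDerivAt (fun x : ℝ => (x : ℂ)) 1 x := Complex.ofRealCLM.hasDerivAt
  rcases eq_or_ne ρ 0 with rfl | hρ
  · simpa [funext sinq_zero_left, cosq] using hid
  · rw [funext (sinq_eq_div hρ)]
    have := ((Complex.hasDerivAt_sin (ρ * x)).comp x (hid.const_mul ρ)).div_const ρ
    refine this.congr_deriv ?_
    rw [cosq]; field_simp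

lemma hasDerivAt_cosq (ρ : ℂ) (x : ℝ) : HasDerivAt (cosq ρ) (-ρ ^ 2 * sinq ρ x) x := by
  have hid : HasDerivAt (fun x : ℝ => (x : ℂ)) 1 x := Complex.ofRealCLM.hasDerivAt
  have := ((Complex.hasDerivAt_cos (ρ * x)).comp x (hid.const_mul ρ))
  refine this.congr_deriv ?_
  rw [← mul_sinq]; ring

lemma differentiable_dslope_sin : Differentiable ℂ (dslope Complex.sin 0) :=
  differentiableOn_univ.1 ((Complex.differentiableOn_dslope univ_mem).2
    Complex.differentiable_sin.differentiableOn)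

lemma continuous_dslope_sin : Continuous (dslope Complex.sin 0) :=
  differentiable_dslope_sin.continuous

@[fun_prop]
lemma Continuous.sinq {α : Type*} [TopologicalSpace α] {f : α → ℂ} {g : α → ℝ}
    (hf : Continuous f) (hg : Continuous g) : Continuous fun x => StarDelay.sinq (f x) (g x) := by
  unfold StarDelay.sinq
  have := continuous_dslope_sin
  fun_prop

@[fun_prop]
lemma Continuous.cosq {α : Type*} [TopologicalSpace α] {f : α → ℂ} {g : α → ℝ}
    (hf : Continuous f) (hg : Continuous g) : Continuous fun x => StarDelay.cosq (f x) (g x) := by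
  unfold StarDelay.cosq
  fun_prop

@[fun_prop]
lemma differentiable_sinq (x : ℝ) : Differentiable ℂ fun ρ => sinq ρ x := by
  unfold sinq
  have := differentiable_dslope_sin
  fun_prop

@[fun_prop]
lemma differentiable_cosq (x : ℝ) : Differentiable ℂ fun ρ => cosq ρ x := by
  unfold cosq
  fun_prop

/-! ### Absolutely continuous complex functions -/

lemma _root_.AbsolutelyContinuousOnInterval.comp_lipschitz {X Y : Type*} [PseudoMetricSpace X]
    [PseudoMetricSpace Y] {f : ℝ → X} {a b : ℝ} (hf : AbsolutelyContinuousOnInterval f a b)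
    {g : X → Y} (hg : LipschitzWith 1 g) : AbsolutelyContinuousOnInterval (g ∘ f) a b := by
  refine squeeze_zero (fun t => Finset.sum_nonneg fun i _ => dist_nonneg) (fun t => ?_) hf
  refine Finset.sum_le_sum fun i _ => ?_
  simpa using hg.dist_le_mul (f (t.2 i).1) (f (t.2 i).2)

lemma _root_.AbsolutelyContinuousOnInterval.congr {X : Type*} [PseudoMetricSpace X]
    {f g : ℝ → X} {a b : ℝ} (hf : AbsolutelyContinuousOnInterval f a b)
    (hfg : EqOn f g (uIcc a b)) : AbsolutelyContinuousOnInterval g a b := by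
  rw [absolutelyContinuousOnInterval_iff] at hf ⊢
  intro ε hε
  obtain ⟨δ, hδ, h⟩ := hf ε hε
  refine ⟨δ, hδ, fun E hE hs => ?_⟩
  convert h E hE hs using 2 with i hi
  have := hE.1 i hi
  rw [hfg this.1, hfg this.2]

lemma _root_.AbsolutelyContinuousOnInterval.ae_differentiableAt_complex {f : ℝ → ℂ} {a b : ℝ}
    (hf : AbsolutelyContinuousOnInterval f a b) :
    ∀ᵐ x : ℝ, x ∈ uIcc a b → DifferentiableAt ℝ f x := by
  have h1 := (hf.comp_lipschitz (g := Complex.re)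
    (LipschitzWith.of_dist_le_mul fun x y => by
      simpa [Complex.dist_eq, Real.dist_eq] using Complex.abs_re_le_norm (x - y))).ae_differentiableAt
  have h2 := (hf.comp_lipschitz (g := Complex.im)
    (LipschitzWith.of_dist_le_mul fun x y => by
      simpa [Complex.dist_eq, Real.dist_eq] using Complex.abs_im_le_norm (x - y))).ae_differentiableAt
  filter_upwards [h1, h2] with x hx1 hx2 hx
  have e1 := (Complex.ofRealCLM.differentiableAt).comp x (hx1 hx)
  have e2 := (Complex.ofRealCLM.differentiableAt).comp x (hx2 hx)
  have := e1.add (e2.mul_const Complex.I)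
  refine this.congr_of_eventuallyEq (Eventually.of_forall fun t => ?_)
  simp [Complex.re_add_im]

lemma absolutelyContinuous_integral_complex {f : ℝ → ℂ} {a b : ℝ}
    (hf : IntervalIntegrable f volume a b) :
    AbsolutelyContinuousOnInterval (fun x => ∫ t in a..x, f t) a b := by
  have hre : IntervalIntegrable (fun t => (f t).re) volume a b :=
    ⟨Integrable.re hf.1, Integrable.re hf.2⟩
  have him : IntervalIntegrable (fun t => (f t).im) volume a b :=
    ⟨Integrable.im hf.1, Integrable.im hf.2⟩
  have L : LipschitzWith 1 ((↑) : ℝ → ℂ) := Complex.isometry_ofReal.lipschitz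
  have h1 := (hre.absolutelyContinuousOnInterval_intervalIntegral left_mem_uIcc).comp_lipschitz L
  have h2 := (him.absolutelyContinuousOnInterval_intervalIntegral left_mem_uIcc).comp_lipschitz L
  refine (h1.add (h2.const_smul Complex.I)).congr fun x hx => ?_
  have hs : uIcc a x ⊆ uIcc a b := uIcc_subset_uIcc_left hx
  simp only [Pi.add_apply, Function.comp, smul_eq_mul]
  rw [← intervalIntegral.integral_ofReal, ← intervalIntegral.integral_ofReal,
    ← intervalIntegral.integral_const_mul, ← intervalIntegral.integral_add]
  · congr 1; ext t; rw [mul_comm]; exact Complex.re_add_im _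
  · exact ⟨Integrable.ofReal (hre.mono_set hs).1, Integrable.ofReal (hre.mono_set hs).2⟩
  · exact IntervalIntegrable.const_mul (f := fun t => (((f t).im : ℝ) : ℂ))
      ⟨Integrable.ofReal (him.mono_set hs).1, Integrable.ofReal (him.mono_set hs).2⟩ _

/-- The difference of `g` and a primitive of `h` is absolutely continuous with zero derivative
almost everywhere, hence constant. -/
lemma _root_.AbsolutelyContinuousOnInterval.integral_eq_sub_complex {g h : ℝ → ℂ} {a b : ℝ}
    (hg : AbsolutelyContinuousOnInterval g a b) (hh : IntervalIntegrable h volume a b)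
    (hd : ∀ᵐ x : ℝ, x ∈ uIcc a b → HasDerivAt g (h x) x) :
    ∫ x in a..b, h x = g b - g a := by
  obtain ⟨C, hC⟩ := (hg.sub (absolutelyContinuous_integral_complex hh)).const_of_ae_hasDerivAt_zero
    (by
      filter_upwards [hd, hh.ae_hasDerivAt_integral] with x h1 h2 hx
      have := (h1 hx).sub (h2 hx a left_mem_uIcc)
      rwa [sub_self] at this)
  have h1 := hC a left_mem_uIcc
  have h2 := hC b right_mem_uIcc
  simp only [Pi.sub_apply, intervalIntegral.integral_same, sub_zero] at h1 h2
  rw [h1, ← h2]; ring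

/-! ### Differentiable functions with absolutely continuous derivative on the edge -/

/-- A function on `[0, 1]`, extended by zero, with absolutely continuous derivative. -/
structure IsRegular (y : ℝ → ℂ) : Prop where
  eq_zero : ∀ x ∉ Icc (0 : ℝ) 1, y x = 0
  differentiable : DifferentiableOn ℝ y (Icc 0 1)
  absCont : AbsolutelyContinuousOnInterval (edgeDeriv y) 0 1

lemma edgeDeriv_of_notMem (f : ℝ → ℂ) {x : ℝ} (hx : x ∉ Icc (0 : ℝ) 1) : edgeDeriv f x = 0 :=
  derivWithin_zero_of_notMem_closure (by rwa [isClosed_Icc.closure_eq])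

lemma edgeDeriv_add {f g : ℝ → ℂ} (hf : DifferentiableOn ℝ f (Icc 0 1))
    (hg : DifferentiableOn ℝ g (Icc 0 1)) : edgeDeriv (f + g) = edgeDeriv f + edgeDeriv g := by
  ext x
  by_cases hx : x ∈ Icc (0 : ℝ) 1
  · exact derivWithin_add (hf x hx) (hg x hx)
  · simp [edgeDeriv_of_notMem _ hx]

lemma edgeDeriv_smul (c : ℂ) (f : ℝ → ℂ) : edgeDeriv (c • f) = c • edgeDeriv f := by
  ext x
  by_cases hx : x ∈ Icc (0 : ℝ) 1
  · exact derivWithin_const_smul_field c f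
  · simp [edgeDeriv_of_notMem _ hx]

lemma edgeDeriv_zero : edgeDeriv (0 : ℝ → ℂ) = 0 := by
  simpa using edgeDeriv_smul 0 0

lemma IsRegular.zero : IsRegular 0 :=
  ⟨fun _ _ => rfl, differentiableOn_const 0, by
    rw [edgeDeriv_zero]
    exact (contDiffOn_const (c := (0 : ℂ))).absolutelyContinuousOnInterval⟩

lemma IsRegular.add {f g : ℝ → ℂ} (hf : IsRegular f) (hg : IsRegular g) : IsRegular (f + g) :=
  ⟨fun x hx => by simp [hf.eq_zero x hx, hg.eq_zero x hx],
    hf.differentiable.add hg.differentiable, by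
    rw [edgeDeriv_add hf.differentiable hg.differentiable]
    exact hf.absCont.add hg.absCont⟩

lemma IsRegular.smul {f : ℝ → ℂ} (c : ℂ) (hf : IsRegular f) : IsRegular (c • f) :=
  ⟨fun x hx => by simp [hf.eq_zero x hx], hf.differentiable.const_smul c, by
    rw [edgeDeriv_smul]
    exact hf.absCont.const_smul c⟩

lemma IsRegular.continuousOn {y : ℝ → ℂ} (hy : IsRegular y) : ContinuousOn y (Icc 0 1) :=
  hy.differentiable.continuousOn

lemma IsRegular.hasDerivAt {y : ℝ → ℂ} (hy : IsRegular y) {x : ℝ} (hx : x ∈ Ioo (0 : ℝ) 1) :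
    HasDerivAt y (edgeDeriv y x) x :=
  (hy.differentiable x (Ioo_subset_Icc_self hx)).hasDerivWithinAt.hasDerivAt (Icc_mem_nhds hx.1 hx.2)

lemma IsRegular.absCont_self {y : ℝ → ℂ} (hy : IsRegular y) :
    AbsolutelyContinuousOnInterval y 0 1 := by
  refine ContDiffOn.absolutelyContinuousOnInterval ?_
  rw [uIcc_of_le zero_le_one]
  have : ContDiffOn ℝ (0 + 1) y (Icc 0 1) :=
    (contDiffOn_succ_iff_derivWithin (uniqueDiffOn_Icc zero_lt_one)).2
      ⟨hy.differentiable, by simp, contDiffOn_zero.2 (by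
        simpa [uIcc_of_le] using! hy.absCont.continuousOn)⟩
  simpa using this

lemma IsRegular.ae_hasDerivAt_edgeDeriv {y : ℝ → ℂ} (hy : IsRegular y) :
    ∀ᵐ x : ℝ, x ∈ Ioo (0 : ℝ) 1 → HasDerivAt (edgeDeriv y) (edgeDeriv (edgeDeriv y) x) x := by
  filter_upwards [hy.absCont.ae_differentiableAt_complex] with x hx hx1
  have h := hx (by rw [uIcc_of_le zero_le_one]; exact Ioo_subset_Icc_self hx1)
  exact h.differentiableWithinAt.hasDerivWithinAt.hasDerivAt (Icc_mem_nhds hx1.1 hx1.2)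

lemma edgeDeriv_edgeDeriv_add_ae {f g : ℝ → ℂ} (hf : IsRegular f) (hg : IsRegular g) :
    ∀ᵐ x : ℝ, x ∈ Ioo (0 : ℝ) 1 → edgeDeriv (edgeDeriv (f + g)) x =
      edgeDeriv (edgeDeriv f) x + edgeDeriv (edgeDeriv g) x := by
  filter_upwards [hf.ae_hasDerivAt_edgeDeriv, hg.ae_hasDerivAt_edgeDeriv] with x h1 h2 hx
  rw [edgeDeriv_add hf.differentiable hg.differentiable]
  have := ((h1 hx).add (h2 hx)).hasDerivWithinAt (s := Icc (0 : ℝ) 1)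
  exact this.derivWithin (uniqueDiffOn_Icc zero_lt_one x (Ioo_subset_Icc_self hx))

/-- Green's formula for `y'' + ρ² y = f` and a smooth solution `w` of `w'' + ρ² w = 0`. -/
lemma IsRegular.green {y : ℝ → ℂ} (hy : IsRegular y) {ρ : ℂ} {f : ℝ → ℂ}
    (hf : IntervalIntegrable f volume 0 1)
    (hode : ∀ᵐ x : ℝ, x ∈ Ioo (0 : ℝ) 1 → edgeDeriv (edgeDeriv y) x = f x - ρ ^ 2 * y x)
    {w w' : ℝ → ℂ} (hw : ∀ x, HasDerivAt w (w' x) x)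
    (hw' : ∀ x, HasDerivAt w' (-ρ ^ 2 * w x) x) {x : ℝ} (hx : x ∈ Icc (0 : ℝ) 1) :
    ∫ t in (0 : ℝ)..x, w t * f t =
      (edgeDeriv y x * w x - y x * w' x) - (edgeDeriv y 0 * w 0 - y 0 * w' 0) := by
  have hsub : uIcc 0 x ⊆ uIcc (0 : ℝ) 1 := by
    rw [uIcc_of_le hx.1, uIcc_of_le zero_le_one]; exact Icc_subset_Icc_right hx.2
  have hwc : Continuous w := continuous_iff_continuousAt.2 fun x => (hw x).continuousAt
  have hw'c : Continuous w' := continuous_iff_continuousAt.2 fun x => (hw' x).continuousAt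
  have acw : AbsolutelyContinuousOnInterval w 0 1 :=
    ContDiffOn.absolutelyContinuousOnInterval (ContDiff.contDiffOn (contDiff_one_iff_deriv.2
      ⟨fun x => (hw x).differentiableAt, by simpa [funext fun x => (hw x).deriv] using hw'c⟩))
  have acw' : AbsolutelyContinuousOnInterval w' 0 1 :=
    ContDiffOn.absolutelyContinuousOnInterval (ContDiff.contDiffOn (contDiff_one_iff_deriv.2
      ⟨fun x => (hw' x).differentiableAt, by
        rw [funext fun x => (hw' x).deriv]; fun_prop⟩))
  have ac : AbsolutelyContinuousOnInterval (fun t => edgeDeriv y t * w t - y t * w' t) 0 1 :=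
    (hy.absCont.smul acw).sub (hy.absCont_self.smul acw')
  refine (ac.mono hsub).integral_eq_sub_complex
    ((hf.mono_set hsub).continuousOn_mul hwc.continuousOn) ?_
  -- Discarding the two end points, a null set, places `t` in the open edge, where `edgeDeriv` is a
  -- genuine derivative.
  have hne : ∀ᵐ t : ℝ, t ≠ 0 ∧ t ≠ x :=
    (Measure.ae_ne volume 0).and (Measure.ae_ne volume x)
  filter_upwards [hy.ae_hasDerivAt_edgeDeriv, hode, hne] with t h1 h2 h3 ht
  rw [uIcc_of_le hx.1] at ht
  have ht' : t ∈ Ioo (0 : ℝ) 1 :=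
    ⟨lt_of_le_of_ne ht.1 h3.1.symm, (lt_of_le_of_ne ht.2 h3.2).trans_le hx.2⟩
  have := ((h1 ht').mul (hw t)).sub ((hy.hasDerivAt ht').mul (hw' t))
  refine this.congr_deriv ?_
  rw [h2 ht']; ring

/-! ### Variation of constants and the Cauchy problem. -/

lemma hasDerivAt_sinq_sub (ρ : ℂ) (x t : ℝ) :
    HasDerivAt (fun t => sinq ρ (x - t)) (-cosq ρ (x - t)) t := by
  have := (hasDerivAt_sinq ρ (x - t)).scomp t ((hasDerivAt_id t).const_sub x)
  simpa using! this

lemma hasDerivAt_cosq_sub (ρ : ℂ) (x t : ℝ) :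
    HasDerivAt (fun t => cosq ρ (x - t)) (ρ ^ 2 * sinq ρ (x - t)) t := by
  have := (hasDerivAt_cosq ρ (x - t)).scomp t ((hasDerivAt_id t).const_sub x)
  simpa using! this

section Representation

variable {y : ℝ → ℂ} {ρ : ℂ} {f : ℝ → ℂ}

/-- The variation of constants formula. -/
lemma IsRegular.eq_variation (hy : IsRegular y) (hf : IntervalIntegrable f volume 0 1)
    (hode : ∀ᵐ x : ℝ, x ∈ Ioo (0 : ℝ) 1 → edgeDeriv (edgeDeriv y) x = f x - ρ ^ 2 * y x)
    {x : ℝ} (hx : x ∈ Icc (0 : ℝ) 1) :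
    y x = y 0 * cosq ρ x + edgeDeriv y 0 * sinq ρ x + ∫ t in (0 : ℝ)..x, sinq ρ (x - t) * f t := by
  rw [hy.green hf hode (w := fun t => sinq ρ (x - t)) (w' := fun t => -cosq ρ (x - t))
    (fun t => hasDerivAt_sinq_sub ρ x t)
    (fun t => by simpa using! (hasDerivAt_cosq_sub ρ x t).neg) hx]
  simp [sinq_zero, cosq_zero]
  ring

lemma IsRegular.edgeDeriv_eq_variation (hy : IsRegular y) (hf : IntervalIntegrable f volume 0 1)
    (hode : ∀ᵐ x : ℝ, x ∈ Ioo (0 : ℝ) 1 → edgeDeriv (edgeDeriv y) x = f x - ρ ^ 2 * y x)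
    {x : ℝ} (hx : x ∈ Icc (0 : ℝ) 1) :
    edgeDeriv y x = y 0 * (-ρ ^ 2 * sinq ρ x) + edgeDeriv y 0 * cosq ρ x +
      ∫ t in (0 : ℝ)..x, cosq ρ (x - t) * f t := by
  rw [hy.green hf hode (w := fun t => cosq ρ (x - t)) (w' := fun t => ρ ^ 2 * sinq ρ (x - t))
    (fun t => hasDerivAt_cosq_sub ρ x t)
    (fun t => by
      have := (hasDerivAt_sinq_sub ρ x t).const_mul (ρ ^ 2)
      exact this.congr_deriv (by ring)) hx]
  simp [sinq_zero, cosq_zero]; ring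

end Representation

/-- Solvability of the Cauchy problem for `y'' + ρ² y = f` with integrable `f`. -/
lemma exists_isRegular (ρ : ℂ) {f : ℝ → ℂ} (hf : IntervalIntegrable f volume 0 1) (y₀ y₁ : ℂ) :
    ∃ y : ℝ → ℂ, IsRegular y ∧ y 0 = y₀ ∧ edgeDeriv y 0 = y₁ ∧
      ∀ᵐ x : ℝ, x ∈ Ioo (0 : ℝ) 1 → edgeDeriv (edgeDeriv y) x = f x - ρ ^ 2 * y x := by
  set g : ℝ → ℂ := (Ioc (0 : ℝ) 1).indicator f with hg
  have hgi : Integrable g := by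
    rw [integrable_indicator_iff measurableSet_Ioc]
    exact (intervalIntegrable_iff_integrableOn_Ioc_of_le zero_le_one).1 hf
  set F : ℝ → ℂ := fun x => ∫ t in (0 : ℝ)..x, g t with hF
  have hFc : Continuous F := intervalIntegral.continuous_primitive (fun _ _ => hgi.intervalIntegrable) 0
  have hFd : ∀ᵐ x : ℝ, HasDerivAt F (g x) x := by
    filter_upwards [LocallyIntegrable.ae_hasDerivAt_integral hgi.locallyIntegrable] with x hx using hx 0
  have hFac : AbsolutelyContinuousOnInterval F 0 1 :=
    absolutelyContinuous_integral_complex hgi.intervalIntegrable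
  -- Since `f` is only integrable, the convolution of `sinq` with `f` is integrated by parts into
  -- that of `cosq` with the continuous primitive `F`. The addition formula for `cosq ρ (x - t)`
  -- then separates the variables into `A` and `B`, which are continuously differentiable.
  set A : ℝ → ℂ := fun x => ∫ t in (0 : ℝ)..x, cosq ρ t * F t with hA
  set B : ℝ → ℂ := fun x => ∫ t in (0 : ℝ)..x, sinq ρ t * F t with hB
  have hAd : ∀ x, HasDerivAt A (cosq ρ x * F x) x := fun x =>
    (Continuous.integral_hasStrictDerivAt (by fun_prop) 0 x).hasDerivAt
  have hBd : ∀ x, HasDerivAt B (sinq ρ x * F x) x := fun x =>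
    (Continuous.integral_hasStrictDerivAt (by fun_prop) 0 x).hasDerivAt
  set w : ℝ → ℂ := fun x => -y₀ * sinq ρ x + cosq ρ x * B x - sinq ρ x * A x with hw
  set u : ℝ → ℂ := fun x =>
    y₀ * cosq ρ x + y₁ * sinq ρ x + (cosq ρ x * A x + ρ ^ 2 * (sinq ρ x * B x)) with hu
  set v : ℝ → ℂ := fun x => F x + (y₁ * cosq ρ x + ρ ^ 2 * w x) with hv
  have hud : ∀ x, HasDerivAt u (v x) x := fun x => by
    have := (((hasDerivAt_cosq ρ x).const_mul y₀).add ((hasDerivAt_sinq ρ x).const_mul y₁)).add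
      (((hasDerivAt_cosq ρ x).mul (hAd x)).add
        (((hasDerivAt_sinq ρ x).mul (hBd x)).const_mul (ρ ^ 2)))
    refine this.congr_deriv ?_
    have e := cosq_sq_add ρ x
    simp only [hv, hw]
    linear_combination F x * e
  have hsd : ∀ x, HasDerivAt (fun x => y₁ * cosq ρ x + ρ ^ 2 * w x) (-ρ ^ 2 * u x) x := fun x => by
    have := ((hasDerivAt_cosq ρ x).const_mul y₁).add
      (((((hasDerivAt_sinq ρ x).const_mul (-y₀)).add ((hasDerivAt_cosq ρ x).mul (hBd x))).sub
        ((hasDerivAt_sinq ρ x).mul (hAd x))).const_mul (ρ ^ 2))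
    refine this.congr_deriv ?_
    simp only [hu]
    ring
  have huc : Continuous u := continuous_iff_continuousAt.2 fun x => (hud x).continuousAt
  have hvac : AbsolutelyContinuousOnInterval v 0 1 := by
    refine hFac.add (ContDiffOn.absolutelyContinuousOnInterval
      (ContDiff.contDiffOn (contDiff_one_iff_deriv.2
        ⟨fun x => (hsd x).differentiableAt, ?_⟩)))
    rw [funext fun x => (hsd x).deriv]
    fun_prop
  have hE : EqOn ((Icc (0 : ℝ) 1).indicator u) u (Icc 0 1) := fun x hx => indicator_of_mem hx u
  have huniq := uniqueDiffOn_Icc (zero_lt_one (α := ℝ))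
  have hEd : ∀ x ∈ Icc (0 : ℝ) 1, edgeDeriv ((Icc (0 : ℝ) 1).indicator u) x = v x := fun x hx => by
    unfold edgeDeriv
    rw [derivWithin_congr hE (hE hx)]
    exact (hud x).hasDerivWithinAt.derivWithin (huniq x hx)
  have h0 : (0 : ℝ) ∈ Icc (0 : ℝ) 1 := left_mem_Icc.2 zero_le_one
  refine ⟨(Icc (0 : ℝ) 1).indicator u, ⟨fun x hx => indicator_of_notMem hx u, ?_, ?_⟩, ?_, ?_, ?_⟩
  · exact DifferentiableOn.congr (fun x _ => (hud x).differentiableAt.differentiableWithinAt) hE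
  · exact hvac.congr fun x hx => (hEd x (by rwa [uIcc_of_le zero_le_one] at hx)).symm
  · rw [hE h0]; simp [hu, hA, cosq_zero, sinq_zero]
  · rw [hEd 0 h0]; simp [hv, hw, hF, hB, hA, cosq_zero, sinq_zero]
  · filter_upwards [hFd] with x hx hx1
    have hx2 := Ioo_subset_Icc_self hx1
    rw [edgeDeriv, derivWithin_congr (fun x hx => hEd x hx) (hEd x hx2), hE hx2]
    have : HasDerivWithinAt v _ (Icc (0 : ℝ) 1) x := (hx.add (hsd x)).hasDerivWithinAt
    rw [this.derivWithin (huniq x hx2), hg,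
      indicator_of_mem (Ioo_subset_Ioc_self hx1)]
    ring

/-! ### Jordan chains of a linear relation with one extra condition -/

section Chains

variable {V : Type*} [AddCommGroup V] [Module ℂ V]

/-- The `k`-th iterated kernel of the relation `G` restricted by `y ∈ D`, `R y = 0`. -/
def IsChainElement (G : Submodule ℂ (V × V)) (D : Submodule ℂ V) (R : D →ₗ[ℂ] ℂ) : ℕ → V → Prop
  | 0, y => y = 0
  | k + 1, y => (∃ hy : y ∈ D, R ⟨y, hy⟩ = 0) ∧ ∃ z, IsChainElement G D R k z ∧ (y, z) ∈ G

variable {G : Submodule ℂ (V × V)} {D : Submodule ℂ V} {R : D →ₗ[ℂ] ℂ} {u : ℕ → D}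

/-- The relation lowers the index along the chain and sends `u 0` to zero; linearity does the rest.
-/
lemma exists_mem_span_right (h0 : ((u 0 : V), (0 : V)) ∈ G)
    (hu : ∀ i, ((u (i + 1) : V), (u i : V)) ∈ G) (k : ℕ) {y : V}
    (hy : y ∈ Submodule.span ℂ ((fun i => (u i : V)) '' Iio (k + 1))) :
    ∃ z ∈ Submodule.span ℂ ((fun i => (u i : V)) '' Iio k), (y, z) ∈ G := by
  induction hy using Submodule.span_induction with
  | mem x hx =>
    obtain ⟨i, hi, rfl⟩ := hx
    rcases i with _ | i
    · exact ⟨0, zero_mem _, h0⟩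
    · exact ⟨u i, Submodule.subset_span ⟨i, by simpa using hi, rfl⟩, hu i⟩
  | zero => exact ⟨0, zero_mem _, G.zero_mem⟩
  | add x y _ _ hx hy =>
    obtain ⟨z, hz, h⟩ := hx
    obtain ⟨z', hz', h'⟩ := hy
    exact ⟨z + z', add_mem hz hz', G.add_mem h h'⟩
  | smul c x _ hx =>
    obtain ⟨z, hz, h⟩ := hx
    exact ⟨c • z, Submodule.smul_mem _ c hz, G.smul_mem c h⟩

lemma exists_mem_span_left (hu : ∀ i, ((u (i + 1) : V), (u i : V)) ∈ G) (k : ℕ) {z : V}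
    (hz : z ∈ Submodule.span ℂ ((fun i => (u i : V)) '' Iio k)) :
    ∃ y ∈ Submodule.span ℂ ((fun i => (u i : V)) '' Iio (k + 1)), (y, z) ∈ G := by
  induction hz using Submodule.span_induction with
  | mem x hx =>
    obtain ⟨i, hi, rfl⟩ := hx
    exact ⟨u (i + 1), Submodule.subset_span ⟨i + 1, by simpa using hi, rfl⟩, hu i⟩
  | zero => exact ⟨0, zero_mem _, G.zero_mem⟩
  | add x y _ _ hx hy =>
    obtain ⟨z, hz, h⟩ := hx
    obtain ⟨z', hz', h'⟩ := hy
    exact ⟨z + z', add_mem hz hz', G.add_mem h h'⟩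
  | smul c x _ hx =>
    obtain ⟨z, hz, h⟩ := hx
    exact ⟨c • z, Submodule.smul_mem _ c hz, G.smul_mem c h⟩

lemma span_chain_le (k : ℕ) : Submodule.span ℂ ((fun i => (u i : V)) '' Iio k) ≤ D :=
  Submodule.span_le.2 (by rintro _ ⟨i, _, rfl⟩; exact (u i).2)

/-- A linear dependence of `u (k + 1)` on its predecessors is pushed down one index by the relation,
which is single-valued on `D` by `hinj`. Descent reaches `u 0 = 0`. -/
lemma chain_notMem_span (h0 : ((u 0 : V), (0 : V)) ∈ G)
    (hu : ∀ i, ((u (i + 1) : V), (u i : V)) ∈ G) (hu0 : (u 0 : V) ≠ 0)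
    (hinj : ∀ z ∈ D, ((0 : V), z) ∈ G → z = 0) (k : ℕ) :
    (u k : V) ∉ Submodule.span ℂ ((fun i => (u i : V)) '' Iio k) := by
  induction k with
  | zero => simpa using hu0
  | succ k ih =>
    intro h
    obtain ⟨z, hz, hG⟩ := exists_mem_span_right h0 hu k h
    have h1 : ((0 : V), (u k : V) - z) ∈ G := by
      simpa using G.sub_mem (hu k) hG
    have := hinj _ (D.sub_mem (u k).2 (span_chain_le k hz)) h1
    rw [sub_eq_zero] at this
    exact ih (this ▸ hz)

lemma range_fin_val_eq {α : Type*} (f : ℕ → α) (p : ℕ) :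
    (range fun i : Fin p => f i) = f '' Iio p := by
  ext x
  exact ⟨fun ⟨i, hi⟩ => ⟨i, i.2, hi⟩, fun ⟨i, hi, h⟩ => ⟨⟨i, hi⟩, h⟩⟩

lemma linearIndependent_chain (h0 : ((u 0 : V), (0 : V)) ∈ G)
    (hu : ∀ i, ((u (i + 1) : V), (u i : V)) ∈ G) (hu0 : (u 0 : V) ≠ 0)
    (hinj : ∀ z ∈ D, ((0 : V), z) ∈ G → z = 0) (p : ℕ) :
    LinearIndependent ℂ (fun i : Fin p => (u i : V)) := by
  induction p with
  | zero => exact linearIndependent_empty_type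
  | succ p ih =>
    rw [linearIndependent_finSucc']
    refine ⟨ih, ?_⟩
    change (u p : V) ∉ Submodule.span ℂ (range fun i : Fin p => (u i : V))
    rw [range_fin_val_eq (fun i => (u i : V))]
    exact chain_notMem_span h0 hu hu0 hinj p

/-- Without the condition `R = 0` the iterated kernels are the spans of initial segments of the
chain, since the kernel is the line through `u 0`. Imposing `R = 0` at every level stops the growth
at the first `u p` with `R (u p) ≠ 0`. -/
lemma rank_span_isChainElement (h0 : ((u 0 : V), (0 : V)) ∈ G)
    (hu : ∀ i, ((u (i + 1) : V), (u i : V)) ∈ G) (hu0 : (u 0 : V) ≠ 0)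
    (hinj : ∀ z ∈ D, ((0 : V), z) ∈ G → z = 0)
    (hker : ∀ y ∈ D, (y, (0 : V)) ∈ G → ∃ c : ℂ, y = c • (u 0 : V))
    {p : ℕ} (hR : ∀ i < p, R (u i) = 0) (hRp : R (u p) ≠ 0) :
    Module.rank ℂ (Submodule.span ℂ {y | ∃ k, IsChainElement G D R k y}) = p := by
  have key : Submodule.span ℂ {y | ∃ k, IsChainElement G D R k y} =
      Submodule.span ℂ (range fun i : Fin p => (u i : V)) := by
    rw [range_fin_val_eq (fun i => (u i : V))]
    apply le_antisymm
    · refine Submodule.span_le.2 ?_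
      rintro y ⟨k, hk⟩
      induction k generalizing y with
      | zero => rw [show y = 0 from hk]; exact zero_mem _
      | succ k ih =>
        obtain ⟨⟨hyD, hyR⟩, z, hz, hyz⟩ := hk
        obtain ⟨w, hw, hwz⟩ := exists_mem_span_left hu p (ih hz)
        have hwD := span_chain_le _ hw
        obtain ⟨c, hc⟩ := hker (y - w) (D.sub_mem hyD hwD) (by simpa using G.sub_mem hyz hwz)
        have hy : y ∈ Submodule.span ℂ ((fun i => (u i : V)) '' Iio (p + 1)) := by
          rw [← sub_add_cancel y w, hc]
          exact add_mem (Submodule.smul_mem _ c (Submodule.subset_span ⟨0, by simp, rfl⟩)) hw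
        -- The coefficient of `u p` is split off. It must vanish, because `R` kills `y` and all
        -- lower chain elements but not `u p`.
        rw [← Order.succ_eq_add_one, Order.Iio_succ_eq_insert, image_insert_eq,
          Submodule.mem_span_insert] at hy
        obtain ⟨e, y', hy', rfl⟩ := hy
        have hy'D := span_chain_le _ hy'
        have hR' : R ⟨y', hy'D⟩ = 0 := by
          have : Submodule.span ℂ (u '' Iio p) ≤ LinearMap.ker R :=
            Submodule.span_le.2 (by rintro _ ⟨i, hi, rfl⟩; exact hR i hi)
          apply this
          have h2 : (fun i => (u i : V)) '' Iio p = D.subtype '' (u '' Iio p) := by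
            rw [image_image]; rfl
          rw [h2, ← Submodule.map_span] at hy'
          obtain ⟨x, hx, rfl⟩ := hy'
          exact hx
        have e1 : (⟨e • (u p : V) + y', hyD⟩ : D) = e • u p + ⟨y', hy'D⟩ := rfl
        rw [e1, map_add, map_smul, hR', add_zero, smul_eq_mul, mul_eq_zero] at hyR
        rw [hyR.resolve_right hRp, zero_smul, zero_add]
        exact hy'
    · refine Submodule.span_mono ?_
      rintro _ ⟨i, hi, rfl⟩
      refine ⟨i + 1, ?_⟩
      have hi' : i < p := hi
      clear hi
      induction i with
      | zero => exact ⟨⟨(u 0).2, hR 0 hi'⟩, 0, rfl, h0⟩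
      | succ i ih => exact ⟨⟨(u _).2, hR _ hi'⟩, u i, ih (by omega), hu i⟩
  rw [key, rank_span (linearIndependent_chain h0 hu hu0 hinj p)]
  simpa using Cardinal.mk_range_eq_of_injective
    (linearIndependent_chain h0 hu hu0 hinj p).injective

end Chains

/-! ### The operator without the Robin condition at one boundary vertex -/

section Relaxed

variable {n : ℕ}

lemma rootCondition_add {ν : Fin 2} {y z : GraphFun n} (hy0 : DifferentiableOn ℝ (y 0) (Icc 0 1))
    (hz0 : DifferentiableOn ℝ (z 0) (Icc 0 1)) (hy : rootCondition ν y)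
    (hz : rootCondition ν z) : rootCondition ν (y + z) := by
  unfold rootCondition at *
  split_ifs at * with h
  · simp [hy, hz]
  · rw [Pi.add_apply, edgeDeriv_add hy0 hz0, Pi.add_apply, hy, hz, add_zero]

lemma rootCondition_smul {ν : Fin 2} {y : GraphFun n} (c : ℂ) (hy : rootCondition ν y) :
    rootCondition ν (c • y) := by
  unfold rootCondition at *
  split_ifs at * with h
  · simp [hy]
  · rw [Pi.smul_apply, edgeDeriv_smul, Pi.smul_apply, hy, smul_zero]

/-- Regular functions on the graph that satisfy all the boundary and matching conditions except
the Robin condition at the end of the edge `j₀.succ`. -/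
def relaxedDomain (H : Fin n → ℂ) (ν : Fin 2) (j₀ : Fin n) : Submodule ℂ (GraphFun n) where
  carrier := {y | (∀ j, IsRegular (y j)) ∧ (∀ j : Fin n, y 0 1 = y j.succ 0) ∧
    edgeDeriv (y 0) 1 = ∑ j : Fin n, edgeDeriv (y j.succ) 0 ∧ rootCondition ν y ∧
    ∀ j ≠ j₀, edgeDeriv (y j.succ) 1 + H j * y j.succ 1 = 0}
  add_mem' := by
    rintro y z ⟨h1, h2, h3, h4, h5⟩ ⟨h1', h2', h3', h4', h5'⟩
    have hd : ∀ j, edgeDeriv (y j + z j) = edgeDeriv (y j) + edgeDeriv (z j) := fun j =>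
      edgeDeriv_add (h1 j).differentiable (h1' j).differentiable
    refine ⟨fun j => (h1 j).add (h1' j), fun j => ?_, ?_,
      rootCondition_add (h1 0).differentiable (h1' 0).differentiable h4 h4', fun j hj => ?_⟩
    · simp [h2 j, h2' j]
    · simp only [hd, Pi.add_apply, h3, h3', Finset.sum_add_distrib]
    · simp only [hd, Pi.add_apply]
      linear_combination h5 j hj + h5' j hj
  zero_mem' := by
    refine ⟨fun j => IsRegular.zero, fun j => rfl, ?_, ?_, fun j hj => ?_⟩
    · simp [edgeDeriv_zero]
    · unfold rootCondition; split_ifs <;> simp [edgeDeriv_zero]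
    · simp [edgeDeriv_zero]
  smul_mem' := by
    rintro c y ⟨h1, h2, h3, h4, h5⟩
    have hd : ∀ j, edgeDeriv (c • y j) = c • edgeDeriv (y j) := fun j => edgeDeriv_smul c (y j)
    refine ⟨fun j => (h1 j).smul c, fun j => ?_, ?_, rootCondition_smul c h4, fun j hj => ?_⟩
    · simp [h2 j]
    · simp only [hd, Pi.smul_apply, h3, Finset.smul_sum]
    · simp only [hd, Pi.smul_apply, smul_eq_mul]
      linear_combination c * h5 j hj

/-- The left-hand side of the Robin condition at the end of the edge `j₀.succ`. -/
def robinDefect (H : Fin n → ℂ) (ν : Fin 2) (j₀ : Fin n) : relaxedDomain H ν j₀ →ₗ[ℂ] ℂ where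
  toFun y := edgeDeriv (y.1 j₀.succ) 1 + H j₀ * y.1 j₀.succ 1
  map_add' y z := by
    have hd : edgeDeriv ((y + z).1 j₀.succ) = edgeDeriv (y.1 j₀.succ) + edgeDeriv (z.1 j₀.succ) :=
      edgeDeriv_add (y.2.1 _).differentiable (z.2.1 _).differentiable
    rw [hd]
    simp
    ring
  map_smul' c y := by
    have hd : edgeDeriv ((c • y).1 j₀.succ) = c • edgeDeriv (y.1 j₀.succ) := edgeDeriv_smul c _
    rw [hd]
    simp
    ring

lemma inDomain_iff {H : Fin n → ℂ} {ν : Fin 2} (j₀ : Fin n) {y : GraphFun n} :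
    InDomain H ν y ↔ ∃ hy : y ∈ relaxedDomain H ν j₀, robinDefect H ν j₀ ⟨y, hy⟩ = 0 := by
  constructor
  · rintro ⟨h1, h2, h3, h4, h5, h6, h7⟩
    exact ⟨⟨fun j => ⟨h1 j, h2 j, h3 j⟩, h4, h5, h6, fun j _ => h7 j⟩, h7 j₀⟩
  · rintro ⟨⟨h1, h2, h3, h4, h5⟩, h6⟩
    refine ⟨fun j => (h1 j).1, fun j => (h1 j).2, fun j => (h1 j).3, h2, h3, h4, fun j => ?_⟩
    rcases eq_or_ne j j₀ with rfl | hj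
    · exact h6
    · exact h5 j hj

lemma delayed_add (a : ℝ) (y z : GraphFun n) (j : Fin (n + 1)) (x : ℝ) :
    delayed a (y + z) j x = delayed a y j x + delayed a z j x := by
  unfold delayed; split_ifs <;> rfl

lemma delayed_smul (a : ℝ) (c : ℂ) (y : GraphFun n) (j : Fin (n + 1)) (x : ℝ) :
    delayed a (c • y) j x = c * delayed a y j x := by
  unfold delayed; split_ifs <;> rfl

lemma diffExpr_zero (a : ℝ) (q : GraphFun n) (j : Fin (n + 1)) (x : ℝ) :
    diffExpr a q 0 j x = 0 := by
  have h2 := delayed_smul a 0 (0 : GraphFun n) j x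
  rw [zero_smul, zero_mul] at h2
  simp [diffExpr, edgeDeriv_zero, h2]

/-- The graph of `L - μ`, where `L` is the operator on the relaxed domain. -/
def relaxedGraph (a : ℝ) (q : GraphFun n) (H : Fin n → ℂ) (ν : Fin 2) (j₀ : Fin n) (μ : ℂ) :
    Submodule ℂ (GraphFun n × GraphFun n) where
  carrier := {p | p.1 ∈ relaxedDomain H ν j₀ ∧
    ∀ j, ∀ᵐ x ∂(volume.restrict (Ioo (0 : ℝ) 1)),
      diffExpr a q p.1 j x - μ * p.1 j x = p.2 j x}
  add_mem' := by
    rintro ⟨y, z⟩ ⟨y', z'⟩ ⟨h1, h2⟩ ⟨h1', h2'⟩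
    refine ⟨add_mem h1 h1', fun j => ?_⟩
    filter_upwards [h2 j, h2' j, (ae_restrict_iff' measurableSet_Ioo).2
      (edgeDeriv_edgeDeriv_add_ae (h1.1 j) (h1'.1 j))] with x e1 e2 e3
    simp only [diffExpr] at e1 e2 ⊢
    change -edgeDeriv (edgeDeriv (y j + y' j)) x + q j x * delayed a (y + y') j x -
      μ * (y j x + y' j x) = z j x + z' j x
    rw [e3, delayed_add]
    linear_combination e1 + e2
  zero_mem' := by
    refine ⟨zero_mem _, fun j => Eventually.of_forall fun x => ?_⟩
    change diffExpr a q 0 j x - μ * 0 = 0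
    rw [diffExpr_zero, mul_zero, sub_zero]
  smul_mem' := by
    rintro c ⟨y, z⟩ ⟨h1, h2⟩
    refine ⟨Submodule.smul_mem _ c h1, fun j => ?_⟩
    filter_upwards [h2 j] with x e1
    simp only [diffExpr] at e1 ⊢
    change -edgeDeriv (edgeDeriv (c • y j)) x + q j x * delayed a (c • y) j x -
      μ * (c * y j x) = c * z j x
    rw [edgeDeriv_smul, edgeDeriv_smul, delayed_smul, Pi.smul_apply, smul_eq_mul]
    linear_combination c * e1

variable {a : ℝ} {q : GraphFun n} {H : Fin n → ℂ} {ν : Fin 2} {j₀ : Fin n} {μ : ℂ}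

lemma isRootFun_iff_isChainElement {k : ℕ} {y : GraphFun n} :
    IsRootFun a q H ν μ k y ↔
      IsChainElement (relaxedGraph a q H ν j₀ μ) (relaxedDomain H ν j₀) (robinDefect H ν j₀) k y := by
  induction k generalizing y with
  | zero => exact Iff.rfl
  | succ k ih =>
    constructor
    · rintro ⟨h1, z, h2, h3⟩
      have h4 := (inDomain_iff j₀).1 h1
      exact ⟨h4, z, ih.1 h2, h4.1, h3⟩
    · rintro ⟨h1, z, h2, h3⟩
      exact ⟨(inDomain_iff j₀).2 h1, z, ih.2 h2, h3.2⟩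

lemma mem_relaxedGraph_sub {y z : GraphFun n} (h : (y, z) ∈ relaxedGraph a q H ν j₀ μ) (ε : ℂ) :
    (y, z - ε • y) ∈ relaxedGraph a q H ν j₀ (μ + ε) := by
  refine ⟨h.1, fun j => ?_⟩
  filter_upwards [h.2 j] with x e
  change diffExpr a q y j x - (μ + ε) * y j x = z j x - ε * y j x
  have e' : diffExpr a q y j x - μ * y j x = z j x := e
  linear_combination e'

/-- For `x < 1 ≤ a` the point `x - a` is negative. On the root edge the delayed value is thus the
zero extension, and on the other edges it is always read off the root edge. This is where the system
becomes triangular. -/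
lemma mem_relaxedGraph_iff (ha : 1 ≤ a) {y z : GraphFun n} :
    (y, z) ∈ relaxedGraph a q H ν j₀ μ ↔ y ∈ relaxedDomain H ν j₀ ∧
      (∀ᵐ x : ℝ, x ∈ Ioo (0 : ℝ) 1 → edgeDeriv (edgeDeriv (y 0)) x = -z 0 x - μ * y 0 x) ∧
      ∀ j : Fin n, ∀ᵐ x : ℝ, x ∈ Ioo (0 : ℝ) 1 → edgeDeriv (edgeDeriv (y j.succ)) x =
        (q j.succ x * y 0 (x - a + 1) - z j.succ x) - μ * y j.succ x := by
  refine and_congr_right fun hy => ?_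
  rw [Fin.forall_fin_succ]
  simp only [ae_restrict_iff' measurableSet_Ioo]
  refine and_congr ?_ (forall_congr' fun j => ?_) <;>
    refine eventually_congr (Eventually.of_forall fun x => forall_congr' fun hx => ?_)
  · have h0 : delayed a y 0 x = 0 := by
      simp only [delayed, ne_eq, not_true_eq_false, false_and, if_false]
      exact (hy.1 0).eq_zero _ fun h => by linarith [h.1, hx.2]
    simp only [diffExpr, h0]
    constructor <;> intro h <;> linear_combination -h
  · have h0 : delayed a y j.succ x = y 0 (x - a + 1) := by
      simp only [delayed]
      rw [if_pos ⟨Fin.succ_ne_zero j, hx.2.trans_le ha⟩]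
    simp only [diffExpr, h0]
    constructor <;> intro h <;> linear_combination -h

/-- The equation holds only almost everywhere, so the relation is not a function on all of `GraphFun
n`; continuity of the elements of the domain restores single-valuedness. -/
lemma eq_zero_of_zero_mem_relaxedGraph {z : GraphFun n} (hz : z ∈ relaxedDomain H ν j₀)
    (h : ((0 : GraphFun n), z) ∈ relaxedGraph a q H ν j₀ μ) : z = 0 := by
  ext j x
  by_cases hx : x ∈ Icc (0 : ℝ) 1
  · refine Measure.eqOn_Icc_of_ae_eq volume zero_ne_one (f := z j) (g := fun _ => 0) ?_
      (hz.1 j).continuousOn continuousOn_const hx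
    rw [← restrict_Ioo_eq_restrict_Icc]
    filter_upwards [h.2 j] with x e
    have e' : diffExpr a q 0 j x - μ * 0 = z j x := e
    rw [← e', diffExpr_zero]; simp
  · exact (hz.1 j).eq_zero x hx

end Relaxed

/-! ### The characteristic function -/

/-- The solution of `y'' + ρ² y = 0` with `y (0) = 1`, `y' (0) = h`. -/
def psi (h ρ : ℂ) (x : ℝ) : ℂ := cosq ρ x + h * sinq ρ x

/-- The derivative of `psi h ρ`. -/
def dpsi (h ρ : ℂ) (x : ℝ) : ℂ := -ρ ^ 2 * sinq ρ x + h * cosq ρ x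

/-- The solution of `y'' + ρ² y = 0` satisfying the root condition number `ν`. -/
def phi (ν : Fin 2) (ρ : ℂ) (x : ℝ) : ℂ := if ν = 0 then sinq ρ x else cosq ρ x

/-- The derivative of `phi ν ρ`. -/
def dphi (ν : Fin 2) (ρ : ℂ) (x : ℝ) : ℂ := if ν = 0 then cosq ρ x else -ρ ^ 2 * sinq ρ x

/-- The contribution of the potential `q` on an edge to the characteristic function. -/
def potInt (a : ℝ) (q : ℝ → ℂ) (h : ℂ) (ν : Fin 2) (ρ : ℂ) : ℂ :=
  ∫ t in (0 : ℝ)..1, psi h ρ (1 - t) * phi ν ρ (t - a + 1) * q t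

/-- The characteristic function of the boundary value problem at `λ = ρ²`. -/
def charFn {n : ℕ} (a : ℝ) (q : GraphFun n) (H : Fin n → ℂ) (ν : Fin 2) (ρ : ℂ) : ℂ :=
  dphi ν ρ 1 * ∏ k, psi (H k) ρ 1 +
    ∑ j, (phi ν ρ 1 * dpsi (H j) ρ 1 + potInt a (q j.succ) (H j) ν ρ) *
      ∏ k ∈ Finset.univ.erase j, psi (H k) ρ 1

lemma hasDerivAt_psi_sub (h ρ : ℂ) (x t : ℝ) :
    HasDerivAt (fun t => psi h ρ (x - t)) (-dpsi h ρ (x - t)) t := by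
  have := (hasDerivAt_cosq_sub ρ x t).add ((hasDerivAt_sinq_sub ρ x t).const_mul h)
  exact this.congr_deriv (by rw [dpsi]; ring)

lemma hasDerivAt_dpsi_sub (h ρ : ℂ) (x t : ℝ) :
    HasDerivAt (fun t => -dpsi h ρ (x - t)) (-ρ ^ 2 * psi h ρ (x - t)) t := by
  have := (((hasDerivAt_sinq_sub ρ x t).const_mul (-ρ ^ 2)).add
    ((hasDerivAt_cosq_sub ρ x t).const_mul h)).neg
  exact this.congr_deriv (by rw [psi]; ring)

@[fun_prop]
lemma Continuous.psi {α : Type*} [TopologicalSpace α] {f : α → ℂ} {g : α → ℝ} (h : ℂ)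
    (hf : Continuous f) (hg : Continuous g) : Continuous fun x => StarDelay.psi h (f x) (g x) := by
  unfold StarDelay.psi; fun_prop

@[fun_prop]
lemma Continuous.dpsi {α : Type*} [TopologicalSpace α] {f : α → ℂ} {g : α → ℝ} (h : ℂ)
    (hf : Continuous f) (hg : Continuous g) : Continuous fun x => StarDelay.dpsi h (f x) (g x) := by
  unfold StarDelay.dpsi; fun_prop

@[fun_prop]
lemma Continuous.phi {α : Type*} [TopologicalSpace α] {f : α → ℂ} {g : α → ℝ} (ν : Fin 2)
    (hf : Continuous f) (hg : Continuous g) : Continuous fun x => StarDelay.phi ν (f x) (g x) := by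
  unfold StarDelay.phi; split_ifs <;> fun_prop

lemma psi_zero (h ρ : ℂ) : psi h ρ 0 = 1 := by simp [psi, cosq_zero, sinq_zero]

lemma dpsi_zero (h ρ : ℂ) : dpsi h ρ 0 = h := by simp [dpsi, cosq_zero, sinq_zero]

/-- The left-hand side of the Robin condition in terms of the initial data. -/
lemma IsRegular.robin_eq {y : ℝ → ℂ} (hy : IsRegular y) {ρ : ℂ} {f : ℝ → ℂ}
    (hf : IntervalIntegrable f volume 0 1)
    (hode : ∀ᵐ x : ℝ, x ∈ Ioo (0 : ℝ) 1 → edgeDeriv (edgeDeriv y) x = f x - ρ ^ 2 * y x) (h : ℂ) :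
    edgeDeriv y 1 + h * y 1 = edgeDeriv y 0 * psi h ρ 1 + y 0 * dpsi h ρ 1 +
      ∫ t in (0 : ℝ)..1, psi h ρ (1 - t) * f t := by
  rw [hy.green hf hode (w := fun t => psi h ρ (1 - t)) (w' := fun t => -dpsi h ρ (1 - t))
    (fun t => hasDerivAt_psi_sub h ρ 1 t) (fun t => hasDerivAt_dpsi_sub h ρ 1 t)
    (right_mem_Icc.2 zero_le_one)]
  simp [psi_zero, dpsi_zero]; ring

lemma IsRegular.intervalIntegrable {y : ℝ → ℂ} (hy : IsRegular y) :
    IntervalIntegrable y volume 0 1 :=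
  (by simpa [uIcc_of_le] using hy.continuousOn : ContinuousOn y (uIcc 0 1)).intervalIntegrable

lemma IsRegular.intervalIntegrable_mul_translate {y : ℝ → ℂ} (hy : IsRegular y) {q : ℝ → ℂ}
    (hq : IntervalIntegrable q volume 0 1) (a : ℝ) :
    IntervalIntegrable (fun t => q t * y (t - a + 1)) volume 0 1 := by
  obtain ⟨M, hM⟩ := isCompact_Icc.exists_bound_of_continuousOn hy.continuousOn
  have hyi : y = (Icc (0 : ℝ) 1).indicator y := by
    ext x
    by_cases hx : x ∈ Icc (0 : ℝ) 1
    · rw [indicator_of_mem hx]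
    · rw [indicator_of_notMem hx, hy.eq_zero x hx]
  have hmeas : AEStronglyMeasurable y volume := by
    rw [hyi, aestronglyMeasurable_indicator_iff measurableSet_Icc]
    exact hy.continuousOn.aestronglyMeasurable measurableSet_Icc
  have hmeas' : AEStronglyMeasurable (fun t => y (t - a + 1)) volume := by
    have hmp : MeasurePreserving (fun t : ℝ => t + (1 - a)) volume volume :=
      measurePreserving_add_right volume (1 - a)
    have := hmeas.comp_measurePreserving hmp
    refine this.congr (Eventually.of_forall fun t => ?_)
    simp only [Function.comp]; ring_nf
  have hbd : ∀ t, ‖y (t - a + 1)‖ ≤ max M 0 := fun t => by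
    by_cases hx : t - a + 1 ∈ Icc (0 : ℝ) 1
    · exact (hM _ hx).trans (le_max_left _ _)
    · rw [hy.eq_zero _ hx, norm_zero]; exact le_max_right _ _
  rw [intervalIntegrable_iff] at hq ⊢
  exact Integrable.mul_bdd hq hmeas'.restrict (Eventually.of_forall hbd)

/-! ### Algebraic multiplicities and the order of zeros of the characteristic function -/

section Multiplicity

variable {n : ℕ} {a : ℝ} {q : GraphFun n} {H : Fin n → ℂ} {ν : Fin 2} {j₀ : Fin n} {ρ : ℂ}

/-- The root data determine the root edge. On each edge other than `j₀` the Robin condition can be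
solved for the initial slope since `psi ≠ 0` there, and Kirchhoff's condition fixes the remaining
slope on `j₀`, where no Robin condition is imposed. -/
lemma exists_relaxed_solution (ha : 1 ≤ a)
    (hq : ∀ j : Fin n, IntervalIntegrable (q j.succ) volume 0 1)
    (hc : ∀ k ≠ j₀, psi (H k) ρ 1 ≠ 0) {z : GraphFun n} (hz : ∀ j, IsRegular (z j)) (A : ℂ) :
    ∃ y, (y, z) ∈ relaxedGraph a q H ν j₀ (ρ ^ 2) ∧ y 0 0 = (if ν = 0 then 0 else A) ∧
      edgeDeriv (y 0) 0 = if ν = 0 then A else 0 := by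
  obtain ⟨y₀, hy₀, h00, h01, hode0⟩ := exists_isRegular ρ (f := fun x => -z 0 x)
    (hz 0).intervalIntegrable.neg (if ν = 0 then 0 else A) (if ν = 0 then A else 0)
  set f : Fin n → ℝ → ℂ := fun j x => q j.succ x * y₀ (x - a + 1) - z j.succ x with hf
  have hfi : ∀ j, IntervalIntegrable (f j) volume 0 1 := fun j =>
    (hy₀.intervalIntegrable_mul_translate (hq j) a).sub (hz j.succ).intervalIntegrable
  set b : Fin n → ℂ := fun j =>
    -(y₀ 1 * dpsi (H j) ρ 1 + ∫ t in (0 : ℝ)..1, psi (H j) ρ (1 - t) * f j t) / psi (H j) ρ 1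
    with hb
  -- The value of `b` at `j₀` may be a division by zero; it is overwritten by the slope that
  -- Kirchhoff's condition demands.
  set B : Fin n → ℂ := Function.update b j₀
    (edgeDeriv y₀ 1 - ∑ j ∈ Finset.univ.erase j₀, b j) with hB
  have hex := fun j : Fin n => exists_isRegular ρ (hfi j) (y₀ 1) (B j)
  choose ys hys hs0 hs1 hodes using hex
  refine ⟨(Fin.cons y₀ ys : GraphFun n), (mem_relaxedGraph_iff ha).2 ⟨⟨?_, ?_, ?_, ?_, ?_⟩, ?_, ?_⟩,
    h00, h01⟩
  · intro j
    refine Fin.cases ?_ (fun i => ?_) j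
    · exact hy₀
    · exact hys i
  · intro j
    exact (hs0 j).symm
  · change edgeDeriv y₀ 1 = ∑ j, edgeDeriv (ys j) 0
    simp only [hs1]
    rw [← Finset.add_sum_erase _ _ (Finset.mem_univ j₀), hB, Function.update_self,
      Finset.sum_congr rfl fun j hj => Function.update_of_ne (Finset.ne_of_mem_erase hj) _ _]
    ring
  · unfold rootCondition
    split_ifs with h
    · change y₀ 0 = 0
      rw [h00, if_pos h]
    · change edgeDeriv y₀ 0 = 0
      rw [h01, if_neg h]
  · intro j hj
    change edgeDeriv (ys j) 1 + H j * ys j 1 = 0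
    rw [(hys j).robin_eq (hfi j) (hodes j), hs0, hs1, hB, Function.update_of_ne hj, hb]
    have := hc j hj
    field_simp
    ring
  · exact hode0
  · intro j
    exact hodes j

lemma eq_zero_of_mem_relaxedGraph_zero (ha : 1 ≤ a)
    (hc : ∀ k ≠ j₀, psi (H k) ρ 1 ≠ 0) {y : GraphFun n}
    (hy : (y, (0 : GraphFun n)) ∈ relaxedGraph a q H ν j₀ (ρ ^ 2)) (h0 : y 0 0 = 0)
    (h1 : edgeDeriv (y 0) 0 = 0) : y = 0 := by
  obtain ⟨⟨hreg, hmatch, hkir, hroot, hrob⟩, hode0, hode⟩ := (mem_relaxedGraph_iff ha).1 hy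
  have hi0 : IntervalIntegrable (fun _ : ℝ => (0 : ℂ)) volume 0 1 := intervalIntegrable_const
  have key : ∀ j : Fin (n + 1), (∀ᵐ x : ℝ, x ∈ Ioo (0 : ℝ) 1 → edgeDeriv (edgeDeriv (y j)) x =
      0 - ρ ^ 2 * y j x) → y j 0 = 0 → edgeDeriv (y j) 0 = 0 → y j = 0 := fun j hj e0 e1 => by
    ext x
    by_cases hx : x ∈ Icc (0 : ℝ) 1
    · rw [(hreg j).eq_variation hi0 hj hx, e0, e1]; simp
    · exact (hreg j).eq_zero x hx
  have hy0 : y 0 = 0 := key 0 (by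
    filter_upwards [hode0] with x hx hx'
    simpa using hx hx') h0 h1
  have hode' : ∀ j : Fin n, ∀ᵐ x : ℝ, x ∈ Ioo (0 : ℝ) 1 → edgeDeriv (edgeDeriv (y j.succ)) x =
      0 - ρ ^ 2 * y j.succ x := fun j => by
    filter_upwards [hode j] with x hx hx'
    simpa [hy0] using hx hx'
  have hs0 : ∀ j : Fin n, y j.succ 0 = 0 := fun j => by rw [← hmatch j, hy0]; rfl
  have hs1 : ∀ j : Fin n, j ≠ j₀ → edgeDeriv (y j.succ) 0 = 0 := fun j hj => by
    have := hrob j hj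
    rw [(hreg j.succ).robin_eq hi0 (hode' j), hs0] at this
    simpa [hc j hj] using this
  have hs1' : ∀ j : Fin n, edgeDeriv (y j.succ) 0 = 0 := fun j => by
    rcases eq_or_ne j j₀ with rfl | hj
    · rw [hy0, edgeDeriv_zero, ← Finset.add_sum_erase _ _ (Finset.mem_univ j),
        Finset.sum_eq_zero fun k hk => hs1 k (Finset.ne_of_mem_erase hk)] at hkir
      simpa using hkir.symm
    · exact hs1 j hj
  ext1 j
  refine Fin.cases hy0 (fun i => ?_) j
  exact key i.succ (hode' i) (hs0 i) (hs1' i)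

/-- The truncated generating function of the chain is an approximate solution at `μ + ε`: the terms
telescope and leave only the residual of order `ε ^ (k + 1)`. -/
lemma sum_pow_chain_mem_relaxedGraph {μ ε : ℂ} {u : ℕ → GraphFun n}
    (h0 : (u 0, (0 : GraphFun n)) ∈ relaxedGraph a q H ν j₀ μ)
    (hu : ∀ i, (u (i + 1), u i) ∈ relaxedGraph a q H ν j₀ μ) (k : ℕ) :
    (∑ i ∈ Finset.range (k + 1), ε ^ i • u i, -(ε ^ (k + 1) • u k)) ∈
      relaxedGraph a q H ν j₀ (μ + ε) := by
  induction k with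
  | zero =>
    have := mem_relaxedGraph_sub h0 ε
    simpa using this
  | succ k ih =>
    have h1 := Submodule.smul_mem _ (ε ^ (k + 1)) (mem_relaxedGraph_sub (hu k) ε)
    have h2 := add_mem ih h1
    rw [Finset.sum_range_succ]
    convert h2 using 1
    rw [Prod.smul_mk, Prod.mk_add_mk, smul_sub, smul_smul, ← pow_succ]
    congr 1
    abel

lemma exists_norm_sinq_cosq_le (ρ₀ : ℂ) : ∃ M, 0 ≤ M ∧ ∀ ρ ∈ Metric.closedBall ρ₀ 1,
    ∀ x ∈ Icc (0 : ℝ) 1, ‖sinq ρ x‖ ≤ M ∧ ‖cosq ρ x‖ ≤ M := by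
  have hK : IsCompact (Metric.closedBall ρ₀ 1 ×ˢ Icc (0 : ℝ) 1) :=
    (isCompact_closedBall ρ₀ 1).prod isCompact_Icc
  obtain ⟨M, hM⟩ := hK.exists_bound_of_continuousOn
    (f := fun p : ℂ × ℝ => sinq p.1 p.2) (by fun_prop)
  obtain ⟨M', hM'⟩ := hK.exists_bound_of_continuousOn
    (f := fun p : ℂ × ℝ => cosq p.1 p.2) (by fun_prop)
  refine ⟨max (max M M') 0, le_max_right _ _, fun ρ hρ x hx => ⟨?_, ?_⟩⟩
  · exact (hM (ρ, x) ⟨hρ, hx⟩).trans ((le_max_left _ _).trans (le_max_left _ _))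
  · exact (hM' (ρ, x) ⟨hρ, hx⟩).trans ((le_max_right _ _).trans (le_max_left _ _))

lemma norm_integral_mul_le {k g : ℝ → ℂ} {M x : ℝ} (hx : x ∈ Icc (0 : ℝ) 1)
    (hM : 0 ≤ M) (hk : ∀ t ∈ Icc (0 : ℝ) x, ‖k t‖ ≤ M) (hg : IntervalIntegrable g volume 0 1) :
    ‖∫ t in (0 : ℝ)..x, k t * g t‖ ≤ M * ∫ t in (0 : ℝ)..1, ‖g t‖ := by
  have hsub : uIcc 0 x ⊆ uIcc (0 : ℝ) 1 := by
    rw [uIcc_of_le hx.1, uIcc_of_le zero_le_one]; exact Icc_subset_Icc_right hx.2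
  calc ‖∫ t in (0 : ℝ)..x, k t * g t‖ ≤ ∫ t in (0 : ℝ)..x, M * ‖g t‖ := by
        refine intervalIntegral.norm_integral_le_of_norm_le hx.1 (Eventually.of_forall fun t ht => ?_)
          ((hg.mono_set hsub).norm.const_mul M)
        rw [norm_mul]
        exact mul_le_mul_of_nonneg_right (hk t (Ioc_subset_Icc_self ht)) (norm_nonneg _)
    _ = M * ∫ t in (0 : ℝ)..x, ‖g t‖ := intervalIntegral.integral_const_mul _ _
    _ ≤ _ := by
        refine mul_le_mul_of_nonneg_left ?_ hM
        exact intervalIntegral.integral_mono_interval le_rfl hx.1 hx.2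
          (Eventually.of_forall fun t => norm_nonneg _) hg.norm

/-- An exact solution with normalised root data would have its defect times the remaining `psi`
factors equal to `charFn`. A residual `δ ρ • z` perturbs each ingredient of that identity by a
locally bounded multiple of `δ ρ`. -/
lemma prod_mul_robinDefect_sub_charFn_isBigO (ha : 1 ≤ a)
    (hq : ∀ j : Fin n, IntervalIntegrable (q j.succ) volume 0 1)
    (hq0 : ∀ j : Fin n, ∀ᵐ x : ℝ, x ∈ Ioo 0 (a - 1) → q j.succ x = 0) {ρ₀ : ℂ} {z : GraphFun n}
    (hz : ∀ j, IsRegular (z j)) {δ : ℂ → ℂ} {U : ℂ → relaxedDomain H ν j₀}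
    (hU : ∀ ρ, ((U ρ : GraphFun n), -(δ ρ • z)) ∈ relaxedGraph a q H ν j₀ (ρ ^ 2))
    (hU0 : ∀ ρ, (U ρ : GraphFun n) 0 0 = if ν = 0 then 0 else 1)
    (hU1 : ∀ ρ, edgeDeriv ((U ρ : GraphFun n) 0) 0 = if ν = 0 then 1 else 0) :
    (fun ρ => (∏ k ∈ Finset.univ.erase j₀, psi (H k) ρ 1) * robinDefect H ν j₀ (U ρ) -
      charFn a q H ν ρ) =O[𝓝 ρ₀] δ := by
  obtain ⟨M, hM, hbd⟩ := exists_norm_sinq_cosq_le ρ₀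
  set N := ∫ t in (0 : ℝ)..1, ‖z 0 t‖ with hN
  have hz0i := (hz 0).intervalIntegrable
  set Y : ℂ → ℝ → ℂ := fun ρ => (U ρ : GraphFun n) 0 with hY
  have hreg : ∀ ρ j, IsRegular ((U ρ : GraphFun n) j) := fun ρ => (U ρ).2.1
  have hode0 : ∀ ρ, ∀ᵐ x : ℝ, x ∈ Ioo (0 : ℝ) 1 →
      edgeDeriv (edgeDeriv (Y ρ)) x = δ ρ * z 0 x - ρ ^ 2 * Y ρ x := fun ρ => by
    filter_upwards [((mem_relaxedGraph_iff ha).1 (hU ρ)).2.1] with x hx hx'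
    simpa using hx hx'
  have hY0 : ∀ ρ, ∀ x ∈ Icc (0 : ℝ) 1,
      Y ρ x - phi ν ρ x = δ ρ * ∫ t in (0 : ℝ)..x, sinq ρ (x - t) * z 0 t := fun ρ x hx => by
    rw [show Y ρ x = _ from (hreg ρ 0).eq_variation (hz0i.const_mul (δ ρ)) (hode0 ρ) hx, hU0, hU1,
      ← intervalIntegral.integral_const_mul, phi]
    have : (fun t => sinq ρ (x - t) * (δ ρ * z 0 t)) =
      fun t => δ ρ * (sinq ρ (x - t) * z 0 t) := by ext t; ring
    rw [this]
    split_ifs <;> ring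
  have hY1 : ∀ ρ, edgeDeriv (Y ρ) 1 - dphi ν ρ 1 =
      δ ρ * ∫ t in (0 : ℝ)..1, cosq ρ (1 - t) * z 0 t := fun ρ => by
    rw [show edgeDeriv (Y ρ) 1 = _ from (hreg ρ 0).edgeDeriv_eq_variation
      (hz0i.const_mul (δ ρ)) (hode0 ρ) (right_mem_Icc.2 zero_le_one), hU0, hU1, ← intervalIntegral.integral_const_mul, dphi]
    have : (fun t => cosq ρ (1 - t) * (δ ρ * z 0 t)) =
      fun t => δ ρ * (cosq ρ (1 - t) * z 0 t) := by ext t; ring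
    rw [this]
    split_ifs <;> ring
  have hball : ∀ᶠ ρ in 𝓝 ρ₀, ρ ∈ Metric.closedBall ρ₀ 1 :=
    Metric.closedBall_mem_nhds ρ₀ one_pos
  have hY0le : ∀ ρ ∈ Metric.closedBall ρ₀ 1, ∀ x ∈ Icc (0 : ℝ) 1,
      ‖Y ρ x - phi ν ρ x‖ ≤ M * N * ‖δ ρ‖ := fun ρ hρ x hx => by
    rw [hY0 ρ x hx, norm_mul, mul_comm]
    refine mul_le_mul_of_nonneg_right (norm_integral_mul_le hx hM (fun t ht => ?_) hz0i)
      (norm_nonneg _)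
    exact (hbd ρ hρ (x - t) ⟨by linarith [ht.2], by linarith [ht.1, hx.2]⟩).1
  have hpsi : ∀ h : ℂ, ∀ ρ ∈ Metric.closedBall ρ₀ 1, ∀ t ∈ Icc (0 : ℝ) 1,
      ‖psi h ρ (1 - t)‖ ≤ M + ‖h‖ * M := fun h ρ hρ t ht => by
    have := hbd ρ hρ (1 - t) ⟨by linarith [ht.2], by linarith [ht.1]⟩
    rw [psi]
    refine (norm_add_le _ _).trans (add_le_add this.2 ?_)
    rw [norm_mul]
    exact mul_le_mul_of_nonneg_left this.1 (norm_nonneg _)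
  have O1 : (fun ρ => edgeDeriv (Y ρ) 1 - dphi ν ρ 1) =O[𝓝 ρ₀] δ := by
    refine IsBigO.of_bound (M * N) (hball.mono fun ρ hρ => ?_)
    rw [hY1, norm_mul, mul_comm]
    refine mul_le_mul_of_nonneg_right (norm_integral_mul_le (right_mem_Icc.2 zero_le_one) hM
      (fun t ht => ?_) hz0i) (norm_nonneg _)
    exact (hbd ρ hρ (1 - t) ⟨by linarith [ht.2], by linarith [ht.1]⟩).2
  have O2 : (fun ρ => Y ρ 1 - phi ν ρ 1) =O[𝓝 ρ₀] δ :=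
    IsBigO.of_bound (M * N) (hball.mono fun ρ hρ => hY0le ρ hρ 1 (right_mem_Icc.2 zero_le_one))
  have hqY : ∀ ρ (j : Fin n), IntervalIntegrable (fun t => q j.succ t * Y ρ (t - a + 1)) volume 0 1 :=
    fun ρ j => (hreg ρ 0).intervalIntegrable_mul_translate (hq j) a
  have hqphi : ∀ ρ (j : Fin n), IntervalIntegrable (fun t => psi (H j) ρ (1 - t) * phi ν ρ (t - a + 1) *
      q j.succ t) volume 0 1 := fun ρ j => (hq j).continuousOn_mul
      (g := fun t => psi (H j) ρ (1 - t) * phi ν ρ (t - a + 1)) (by fun_prop)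
  have hpY : ∀ ρ (j : Fin n), IntervalIntegrable (fun t => psi (H j) ρ (1 - t) *
      (q j.succ t * Y ρ (t - a + 1))) volume 0 1 := fun ρ j =>
    (hqY ρ j).continuousOn_mul (g := fun t => psi (H j) ρ (1 - t)) (by fun_prop)
  have O3 : ∀ j : Fin n, (fun ρ => (∫ t in (0 : ℝ)..1, psi (H j) ρ (1 - t) *
      (q j.succ t * Y ρ (t - a + 1))) - potInt a (q j.succ) (H j) ν ρ) =O[𝓝 ρ₀] δ := fun j => by
    refine IsBigO.of_bound ((M + ‖H j‖ * M) * (M * N) * ∫ t in (0 : ℝ)..1, ‖q j.succ t‖)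
      (hball.mono fun ρ hρ => ?_)
    rw [potInt, ← intervalIntegral.integral_sub (hpY ρ j) (hqphi ρ j)]
    calc _ ≤ ∫ t in (0 : ℝ)..1, (M + ‖H j‖ * M) * (M * N * ‖δ ρ‖) * ‖q j.succ t‖ := by
          refine intervalIntegral.norm_integral_le_of_norm_le zero_le_one ?_
            ((hq j).norm.const_mul _)
          filter_upwards [hq0 j, Measure.ae_ne volume (1 : ℝ)] with t ht ht1 htI
          -- Where the shifted argument leaves the root edge the potential vanishes; elsewhere the
          -- bound on `Y - phi` applies.
          by_cases h : t < a - 1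
          · simp [ht ⟨htI.1, h⟩]
          · have e : psi (H j) ρ (1 - t) * (q j.succ t * Y ρ (t - a + 1)) -
                psi (H j) ρ (1 - t) * phi ν ρ (t - a + 1) * q j.succ t =
                psi (H j) ρ (1 - t) * (Y ρ (t - a + 1) - phi ν ρ (t - a + 1)) * q j.succ t := by
              ring
            rw [e, norm_mul, norm_mul]
            have h1 := hpsi (H j) ρ hρ t (Ioc_subset_Icc_self htI)
            have h2 := hY0le ρ hρ (t - a + 1) ⟨by linarith, by linarith [htI.2]⟩
            gcongr
      _ = _ := by rw [intervalIntegral.integral_const_mul]; ring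
  have O4 : ∀ j : Fin n, (fun ρ => δ ρ * ∫ t in (0 : ℝ)..1, psi (H j) ρ (1 - t) * z j.succ t) =O[𝓝 ρ₀] δ :=
    fun j => by
    refine IsBigO.of_bound ((M + ‖H j‖ * M) * ∫ t in (0 : ℝ)..1, ‖z j.succ t‖)
      (hball.mono fun ρ hρ => ?_)
    rw [norm_mul, mul_comm]
    refine mul_le_mul_of_nonneg_right (norm_integral_mul_le (right_mem_Icc.2 zero_le_one)
      (by positivity) (fun t ht => hpsi _ ρ hρ t ht) (hz _).intervalIntegrable) (norm_nonneg _)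
  have C1 : ∀ {g : ℂ → ℂ}, Continuous g → g =O[𝓝 ρ₀] fun _ => (1 : ℂ) := fun hg =>
    hg.continuousAt.tendsto.isBigO_one ℂ
  have hrob : ∀ ρ (j : Fin n), edgeDeriv ((U ρ : GraphFun n) j.succ) 1 + H j * (U ρ : GraphFun n) j.succ 1 =
      edgeDeriv ((U ρ : GraphFun n) j.succ) 0 * psi (H j) ρ 1 + Y ρ 1 * dpsi (H j) ρ 1 +
        ((∫ t in (0 : ℝ)..1, psi (H j) ρ (1 - t) * (q j.succ t * Y ρ (t - a + 1))) +
          δ ρ * ∫ t in (0 : ℝ)..1, psi (H j) ρ (1 - t) * z j.succ t) := fun ρ j => by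
    have hzj := ((hz j.succ).intervalIntegrable.continuousOn_mul
      (g := fun t => psi (H j) ρ (1 - t)) (by fun_prop)).const_mul (δ ρ)
    rw [← intervalIntegral.integral_const_mul, ← intervalIntegral.integral_add (hpY ρ j) hzj,
      (hreg ρ j.succ).robin_eq ((hqY ρ j).add ((hz j.succ).intervalIntegrable.const_mul (δ ρ)))
        (by
          filter_upwards [((mem_relaxedGraph_iff ha).1 (hU ρ)).2.2 j] with x hx hx'
          simpa using hx hx'), show Y ρ 1 = _ from (U ρ).2.2.1 j]
    congr 2
    ext t
    ring
  have hsum : ∀ ρ, (∏ k ∈ Finset.univ.erase j₀, psi (H k) ρ 1) * robinDefect H ν j₀ (U ρ) -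
      charFn a q H ν ρ = (edgeDeriv (Y ρ) 1 - dphi ν ρ 1) * (∏ k, psi (H k) ρ 1) +
      ∑ j, ((Y ρ 1 - phi ν ρ 1) * dpsi (H j) ρ 1 +
        (((∫ t in (0 : ℝ)..1, psi (H j) ρ (1 - t) * (q j.succ t * Y ρ (t - a + 1))) -
          potInt a (q j.succ) (H j) ν ρ) +
          δ ρ * ∫ t in (0 : ℝ)..1, psi (H j) ρ (1 - t) * z j.succ t)) *
        ∏ k ∈ Finset.univ.erase j, psi (H k) ρ 1 := fun ρ => by
    -- All other Robin defects are zero, so the sum can be extended over all edges, which makes it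
    -- symmetric in `j` like `charFn`.
    have e1 : (∏ k ∈ Finset.univ.erase j₀, psi (H k) ρ 1) * robinDefect H ν j₀ (U ρ) =
        ∑ j, (edgeDeriv ((U ρ : GraphFun n) j.succ) 1 + H j * (U ρ : GraphFun n) j.succ 1) *
          ∏ k ∈ Finset.univ.erase j, psi (H k) ρ 1 := by
      rw [Finset.sum_eq_single j₀ (fun j _ hj => by rw [(U ρ).2.2.2.2.2 j hj, zero_mul]) (by simp),
        mul_comm]
      rfl
    have e2 : ∀ j, (∏ k, psi (H k) ρ 1) =
        psi (H j) ρ 1 * ∏ k ∈ Finset.univ.erase j, psi (H k) ρ 1 := fun j =>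
      (Finset.mul_prod_erase _ _ (Finset.mem_univ j)).symm
    -- Kirchhoff's condition removes the unknown initial slopes.
    have e3 : edgeDeriv (Y ρ) 1 * (∏ k, psi (H k) ρ 1) =
        ∑ j, edgeDeriv ((U ρ : GraphFun n) j.succ) 0 * (psi (H j) ρ 1 *
          ∏ k ∈ Finset.univ.erase j, psi (H k) ρ 1) := by
      rw [show edgeDeriv (Y ρ) 1 = _ from (U ρ).2.2.2.1, Finset.sum_mul]
      exact Finset.sum_congr rfl fun j _ => by rw [← e2 j]
    rw [e1, charFn, sub_mul, e3, sub_add_eq_sub_sub, sub_right_comm, ← Finset.sum_sub_distrib,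
      sub_add_eq_add_sub, ← Finset.sum_add_distrib]
    congr 1
    refine Finset.sum_congr rfl fun j _ => ?_
    rw [hrob]; ring
  simp_rw [hsum]
  refine IsBigO.add ?_ (IsBigO.fun_sum fun j _ => ?_)
  · simpa using O1.mul (C1 (g := fun ρ => ∏ k, psi (H k) ρ 1) (by fun_prop))
  · have h1 : (fun ρ => (Y ρ 1 - phi ν ρ 1) * dpsi (H j) ρ 1) =O[𝓝 ρ₀] δ := by
      simpa using O2.mul (C1 (g := fun ρ => dpsi (H j) ρ 1) (by fun_prop))
    simpa using (h1.add ((O3 j).add (O4 j))).mul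
      (C1 (g := fun ρ => ∏ k ∈ Finset.univ.erase j, psi (H k) ρ 1) (by fun_prop))

/-- An analytic function that is not locally zero has a finite order of vanishing. -/
lemma eventually_eq_zero_of_forall_isBigO_pow {f : ℂ → ℂ} {z₀ : ℂ} (hf : AnalyticAt ℂ f z₀)
    (h : ∀ k : ℕ, f =O[𝓝 z₀] fun z => (z - z₀) ^ k) : ∀ᶠ z in 𝓝 z₀, f z = 0 := by
  by_contra hne
  obtain ⟨m, g, hg, hg0, hfg⟩ := hf.exists_eventuallyEq_pow_smul_nonzero_iff.2 hne
  have h1 : (fun z => (z - z₀) ^ m) =O[𝓝 z₀] f := by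
    have hinv : (fun z => (g z)⁻¹) =O[𝓝 z₀] fun _ => (1 : ℂ) :=
      (hg.continuousAt.inv₀ hg0).tendsto.isBigO_one ℂ
    have h2 : (fun z => f z * (g z)⁻¹) =O[𝓝 z₀] f := by
      simpa using (isBigO_refl f (𝓝 z₀)).mul hinv
    refine h2.congr' ?_ EventuallyEq.rfl
    filter_upwards [hfg, hg.continuousAt.eventually_ne hg0] with z hz hgz
    rw [hz, smul_eq_mul]; field_simp
  have h2 : (fun z => (z - z₀) ^ m) =O[𝓝 z₀] fun z => (z - z₀) ^ (m + 1) := h1.trans (h (m + 1))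
  have h3 : (fun z : ℂ => (z - z₀) ^ (m + 1)) =o[𝓝 z₀] fun z => (z - z₀) ^ m := by
    have : (fun z : ℂ => z - z₀) =o[𝓝 z₀] fun _ => (1 : ℂ) :=
      (isLittleO_one_iff ℂ).2 (by
        simpa using (by fun_prop : Continuous fun z : ℂ => z - z₀).tendsto z₀)
    simpa [pow_succ] using (isBigO_refl (fun z : ℂ => (z - z₀) ^ m) (𝓝 z₀)).mul_isLittleO this
  have h4 := (h2.trans_isLittleO h3).mono (nhdsWithin_le_nhds (s := {z₀}ᶜ))
  refine isLittleO_irrefl ?_ h4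
  refine Eventually.frequently ?_
  filter_upwards [self_mem_nhdsWithin] with z hz
  exact pow_ne_zero _ (sub_ne_zero.2 hz)

/-- The algebraic multiplicity of an eigenvalue is the order of the corresponding zero of the
characteristic function. -/
lemma exists_algMultiplicity_eq_and_isTheta (ha : 1 ≤ a)
    (hq : ∀ j : Fin n, IntervalIntegrable (q j.succ) volume 0 1)
    (hq0 : ∀ j : Fin n, ∀ᵐ x : ℝ, x ∈ Ioo 0 (a - 1) → q j.succ x = 0) {ρ₀ : ℂ}
    (hc : ∀ k ≠ j₀, psi (H k) ρ₀ 1 ≠ 0) (han : AnalyticAt ℂ (charFn a q H ν) ρ₀)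
    (hne : ¬ ∀ᶠ ρ in 𝓝 ρ₀, charFn a q H ν ρ = 0) :
    ∃ p : ℕ, algMultiplicity a q H ν (ρ₀ ^ 2) = p ∧
      charFn a q H ν =Θ[𝓝 ρ₀] fun ρ => (ρ ^ 2 - ρ₀ ^ 2) ^ p := by
  set G := relaxedGraph a q H ν j₀ (ρ₀ ^ 2) with hG
  set D := relaxedDomain H ν j₀ with hD
  set R := robinDefect H ν j₀ with hR
  obtain ⟨y₀, hy₀, hy₀0, hy₀1⟩ := exists_relaxed_solution (ν := ν) ha hq hc
    (z := 0) (fun _ => IsRegular.zero) 1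
  have hex : ∀ z : D, ∃ y : D, ((y : GraphFun n), (z : GraphFun n)) ∈ G ∧
      (y : GraphFun n) 0 0 = 0 ∧ edgeDeriv ((y : GraphFun n) 0) 0 = 0 := fun z => by
    obtain ⟨y, hy, h0, h1⟩ := exists_relaxed_solution (ν := ν) ha hq hc z.2.1 0
    exact ⟨⟨y, hy.1⟩, hy, by simpa using h0, by simpa using h1⟩
  -- `T` is a right inverse of `L - ρ₀²` with zero root data. Its iterates extend `y₀` to an
  -- infinite chain, and any combination of the chain with coefficient one at `u 0` keeps the
  -- normalised root data.
  choose T hT hT0 hT1 using hex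
  set u : ℕ → D := fun i => T^[i] ⟨y₀, hy₀.1⟩ with hu
  have hu0 : (u 0 : GraphFun n) = y₀ := rfl
  have hus : ∀ i, u (i + 1) = T (u i) := fun i => Function.iterate_succ_apply' T i _
  have h0 : ((u 0 : GraphFun n), (0 : GraphFun n)) ∈ G := hy₀
  have hstep : ∀ i, ((u (i + 1) : GraphFun n), (u i : GraphFun n)) ∈ G := fun i => by
    rw [hus]; exact hT _
  have hy₀ne : (u 0 : GraphFun n) ≠ 0 := fun h => by
    rw [hu0] at h
    rw [h] at hy₀0 hy₀1
    have e : edgeDeriv ((0 : GraphFun n) 0) 0 = 0 := congrFun edgeDeriv_zero 0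
    rw [e] at hy₀1
    by_cases hν : ν = 0 <;> simp [hν] at hy₀0 hy₀1
  have hker : ∀ y ∈ D, (y, (0 : GraphFun n)) ∈ G → ∃ c : ℂ, y = c • (u 0 : GraphFun n) := by
    intro y hy hyG
    set c : ℂ := if ν = 0 then edgeDeriv (y 0) 0 else y 0 0 with hcdef
    refine ⟨c, sub_eq_zero.1 (eq_zero_of_mem_relaxedGraph_zero ha hc (by
      simpa using G.sub_mem hyG (G.smul_mem c h0)) ?_ ?_)⟩
    · have hr := hy.2.2.2.1
      unfold rootCondition at hr
      change y 0 0 - c * y₀ 0 0 = 0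
      rw [hy₀0, hcdef]
      split_ifs with hν
      · rw [if_pos hν] at hr; simp [hr]
      · simp
    · have hr := hy.2.2.2.1
      unfold rootCondition at hr
      have e : edgeDeriv ((y - c • (u 0 : GraphFun n)) 0) =
          edgeDeriv (y 0) + edgeDeriv ((-c) • y₀ 0) := by
        rw [← edgeDeriv_add (hy.1 0).differentiable ((hy₀.1.1 0).smul _).differentiable, hu0]
        congr 1
        rw [neg_smul, ← sub_eq_add_neg]; rfl
      rw [e, edgeDeriv_smul, Pi.add_apply, Pi.smul_apply, hy₀1, hcdef, smul_eq_mul]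
      split_ifs with hν
      · simp
      · rw [if_neg hν] at hr; simp [hr]
  have hexp : ∀ k : ℕ, (fun ρ => (∏ k ∈ Finset.univ.erase j₀, psi (H k) ρ 1) *
      (∑ i ∈ Finset.range (k + 1), (ρ ^ 2 - ρ₀ ^ 2) ^ i * R (u i)) - charFn a q H ν ρ) =O[𝓝 ρ₀]
      fun ρ => (ρ ^ 2 - ρ₀ ^ 2) ^ (k + 1) := fun k => by
    have := prod_mul_robinDefect_sub_charFn_isBigO (a := a) (q := q) (H := H) (ν := ν) (j₀ := j₀)
      ha hq hq0 (ρ₀ := ρ₀) (z := u k) (u k).2.1 (δ := fun ρ => (ρ ^ 2 - ρ₀ ^ 2) ^ (k + 1))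
      (U := fun ρ => ∑ i ∈ Finset.range (k + 1), (ρ ^ 2 - ρ₀ ^ 2) ^ i • u i)
      (fun ρ => by
        have := sum_pow_chain_mem_relaxedGraph (ε := ρ ^ 2 - ρ₀ ^ 2)
          (u := fun i => (u i : GraphFun n)) h0 hstep k
        simpa using this) (fun ρ => ?_) (fun ρ => ?_)
    · simpa using this
    · simp only [AddSubmonoidClass.coe_finsetSum, Finset.sum_apply, Submodule.coe_smul,
        Pi.smul_apply]
      rw [Finset.sum_range_succ', Finset.sum_eq_zero fun i _ => by rw [hus, hT0, smul_zero],
        hu0, hy₀0]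
      simp
    · have key : ∀ k : ℕ, edgeDeriv (((∑ i ∈ Finset.range (k + 1),
          (ρ ^ 2 - ρ₀ ^ 2) ^ i • u i : D) : GraphFun n) 0) 0 = edgeDeriv (y₀ 0) 0 := fun k => by
        induction k with
        | zero => simp [hu0]
        | succ k ih =>
          rw [Finset.sum_range_succ, Submodule.coe_add, Pi.add_apply,
            edgeDeriv_add ((Subtype.prop _ : _ ∈ D).1 0).differentiable
              ((Subtype.prop _ : _ ∈ D).1 0).differentiable, Pi.add_apply, ih,
            Submodule.coe_smul, Pi.smul_apply, edgeDeriv_smul, Pi.smul_apply, hus, hT1]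
          simp
      rw [key, hy₀1]
  have hεO : (fun ρ : ℂ => ρ ^ 2 - ρ₀ ^ 2) =O[𝓝 ρ₀] fun ρ => ρ - ρ₀ := by
    have : (fun ρ : ℂ => ρ + ρ₀) =O[𝓝 ρ₀] fun _ => (1 : ℂ) :=
      (continuous_id.add continuous_const).continuousAt.tendsto.isBigO_one ℂ
    refine ((isBigO_refl (fun ρ : ℂ => ρ - ρ₀) (𝓝 ρ₀)).mul this).congr (fun ρ => by ring)
      (fun ρ => by ring)
  -- If every chain element met the Robin condition, `charFn` would vanish to infinite order at
  -- `ρ₀`.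
  have hexd : ∃ i, R (u i) ≠ 0 := by
    by_contra! hall
    refine hne (eventually_eq_zero_of_forall_isBigO_pow han fun k => ?_)
    have h1 : (charFn a q H ν) =O[𝓝 ρ₀] fun ρ => (ρ ^ 2 - ρ₀ ^ 2) ^ (k + 1) := by
      simpa [hall] using (hexp k).neg_left
    refine (h1.trans (hεO.pow (k + 1))).trans ?_
    have : (fun ρ : ℂ => ρ - ρ₀) =O[𝓝 ρ₀] fun _ => (1 : ℂ) :=
      (continuous_id.sub continuous_const).continuousAt.tendsto.isBigO_one ℂ
    simpa [pow_succ] using (isBigO_refl (fun ρ : ℂ => (ρ - ρ₀) ^ k) (𝓝 ρ₀)).mul this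
  classical
  set p := Nat.find hexd with hp
  have hpne : R (u p) ≠ 0 := Nat.find_spec hexd
  have hplt : ∀ i < p, R (u i) = 0 := fun i hi => not_not.1 (Nat.find_min hexd hi)
  refine ⟨p, ?_, ?_⟩
  · rw [algMultiplicity, rootSpace, ← rank_span_isChainElement (R := R) h0 hstep hy₀ne
      (fun z hz h => eq_zero_of_zero_mem_relaxedGraph hz h) hker hplt hpne]
    have hset : {y | ∃ k, IsRootFun a q H ν (ρ₀ ^ 2) k y} = {y | ∃ k, IsChainElement G D R k y} :=
      Set.ext fun y => exists_congr fun k => isRootFun_iff_isChainElement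
    rw [hset]
  · set P : ℂ → ℂ := fun ρ => ∏ k ∈ Finset.univ.erase j₀, psi (H k) ρ 1 with hP
    have hPc : Continuous P := by fun_prop
    have hP0 : P ρ₀ ≠ 0 := Finset.prod_ne_zero_iff.2 fun k hk => hc k (Finset.ne_of_mem_erase hk)
    have h1 := hexp p
    have h2 : (fun ρ : ℂ => (ρ ^ 2 - ρ₀ ^ 2) ^ (p + 1)) =o[𝓝 ρ₀] fun ρ => (ρ ^ 2 - ρ₀ ^ 2) ^ p := by
      have : (fun ρ : ℂ => ρ ^ 2 - ρ₀ ^ 2) =o[𝓝 ρ₀] fun _ => (1 : ℂ) := by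
        refine (isLittleO_one_iff ℂ).2 ?_
        have := (by fun_prop : Continuous fun ρ : ℂ => ρ ^ 2 - ρ₀ ^ 2).tendsto ρ₀
        simpa using this
      simpa only [pow_succ _ p, mul_one] using
        (isBigO_refl (fun ρ : ℂ => (ρ ^ 2 - ρ₀ ^ 2) ^ p) (𝓝 ρ₀)).mul_isLittleO this
    have h3 : (fun ρ => P ρ * R (u p) * (ρ ^ 2 - ρ₀ ^ 2) ^ p - charFn a q H ν ρ) =o[𝓝 ρ₀]
        fun ρ => (ρ ^ 2 - ρ₀ ^ 2) ^ p := by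
      refine (h1.trans_isLittleO h2).congr_left fun ρ => ?_
      rw [Finset.sum_range_succ, Finset.sum_eq_zero fun i hi => by
        rw [hplt i (Finset.mem_range.1 hi), mul_zero]]
      ring
    have hcont : ContinuousAt (fun ρ => P ρ * R (u p)) ρ₀ := by fun_prop
    have h4 : (fun ρ => P ρ * R (u p) * (ρ ^ 2 - ρ₀ ^ 2) ^ p) =Θ[𝓝 ρ₀]
        fun ρ => (ρ ^ 2 - ρ₀ ^ 2) ^ p := by
      have h5 : (fun ρ => P ρ * R (u p)) =Θ[𝓝 ρ₀] fun _ => (1 : ℂ) := by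
        refine ⟨hcont.tendsto.isBigO_one ℂ, ?_⟩
        have := (hcont.inv₀ (mul_ne_zero hP0 hpne)).tendsto.isBigO_one ℂ
        refine (this.mul (isBigO_refl (fun ρ => P ρ * R (u p)) (𝓝 ρ₀))).congr' ?_ ?_
        · filter_upwards [hcont.eventually_ne (mul_ne_zero hP0 hpne)] with ρ hρ
          exact inv_mul_cancel₀ hρ
        · exact Eventually.of_forall fun ρ => one_mul _
      simpa using h5.mul (isTheta_refl (fun ρ : ℂ => (ρ ^ 2 - ρ₀ ^ 2) ^ p) (𝓝 ρ₀))
    refine EventuallyEq.trans_isTheta (Eventually.of_forall fun ρ => ?_)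
      (h4.add_isLittleO h3.neg_left)
    simp only [Pi.add_apply]
    ring

end Multiplicity

/-! ### Quotients of entire functions -/

/-- A quotient of entire functions that is locally bounded is entire. -/
lemma exists_differentiable_eq_mul {f g : ℂ → ℂ} (hf : Differentiable ℂ f)
    (hg : Differentiable ℂ g) (hne : ∀ z, ¬ ∀ᶠ w in 𝓝 z, g w = 0) (hO : ∀ z, f =O[𝓝 z] g) :
    ∃ h : ℂ → ℂ, Differentiable ℂ h ∧ ∀ z, f z = h z * g z := by
  set F : ℂ → ℂ := fun w => f w / g w with hF
  have hlim : ∀ w, g w ≠ 0 → limUnder (𝓝[≠] w) F = F w := fun w hw =>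
    Tendsto.limUnder_eq (((hf w).continuousAt.div (hg w).continuousAt hw).tendsto.mono_left
      nhdsWithin_le_nhds)
  refine ⟨fun z => limUnder (𝓝[≠] z) F, fun z => ?_, fun z => ?_⟩
  · have h1 : ∀ᶠ w in 𝓝[≠] z, g w ≠ 0 :=
      (hg.analyticAt z).eventually_eq_zero_or_eventually_ne_zero.resolve_left (hne z)
    obtain ⟨C, hC⟩ := (hO z).bound
    rw [eventually_nhdsWithin_iff] at h1
    obtain ⟨s, hs, hso, hzs⟩ := _root_.eventually_nhds_iff.1 (h1.and hC)
    have hd : DifferentiableOn ℂ F (s \ {z}) := fun w hw =>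
      ((hf w).div (hg w) ((hs w hw.1).1 hw.2)).differentiableWithinAt
    have hb : BddAbove (norm ∘ F '' (s \ {z})) := by
      refine ⟨C, ?_⟩
      rintro _ ⟨w, hw, rfl⟩
      have := (hs w hw.1).1 hw.2
      simp only [Function.comp, hF, norm_div]
      rw [div_le_iff₀ (norm_pos_iff.2 this)]
      exact (hs w hw.1).2
    have h2 := Complex.differentiableOn_update_limUnder_of_bddAbove (hso.mem_nhds hzs) hd hb
    refine (h2.differentiableAt (hso.mem_nhds hzs)).congr_of_eventuallyEq ?_
    filter_upwards [hso.mem_nhds hzs] with w hw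
    rcases eq_or_ne w z with rfl | hwz
    · rw [Function.update_self]
    · rw [Function.update_of_ne hwz]
      exact hlim w ((hs w hw).1 hwz)
  -- The filter `𝓝 z` includes `z` itself, so the bound forces `f z = 0` wherever `g z = 0`.
  · by_cases h : g z = 0
    · obtain ⟨C, hC⟩ := (hO z).bound
      have := hC.self_of_nhds
      rw [h, norm_zero, mul_zero] at this
      rw [h, mul_zero]
      exact norm_le_zero_iff.1 this
    · simp only
      rw [hlim z h, hF]
      field_simp

/-- The part of the complex plane in which the trigonometric functions are bounded below by a
multiple of `exp |Im z|`. -/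
def farRegion : Set ℂ := {z | Real.cos z.re ^ 2 = 1 / 4 ∨ 1 ≤ |z.im|}

/-- `farRegion` contains the boundaries of arbitrarily large rectangles, so the maximum principle
carries the bound to the whole plane with no growth assumption on `h`. -/
lemma norm_le_of_norm_le_on_farRegion {h : ℂ → ℂ} (hh : Differentiable ℂ h) {K r : ℝ}
    (hK : ∀ z ∈ farRegion, r ≤ ‖z‖ → ‖h z‖ ≤ K) (z : ℂ) : ‖h z‖ ≤ K := by
  obtain ⟨N, hN⟩ := exists_nat_ge (max (max 1 r) (‖z‖ + 1))
  have hN1 : (1 : ℝ) ≤ N := (le_max_left _ _).trans ((le_max_left _ _).trans hN)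
  have hNr : r ≤ N := (le_max_right _ _).trans ((le_max_left _ _).trans hN)
  have hNz : ‖z‖ + 1 ≤ N := (le_max_right _ _).trans hN
  -- The vertical sides lie where `cos² (Re z) = 1/4`, the horizontal ones where `|Im z| = N ≥ 1`.
  set X : ℝ := N * Real.pi + Real.pi / 3 with hX
  have hXN : (N : ℝ) ≤ X := by nlinarith [Real.pi_gt_three]
  set U : Set ℂ := Ioo (-X) X ×ℂ Ioo (-(N : ℝ)) N with hU
  have hUb : Bornology.IsBounded U := (Metric.isBounded_Ioo _ _).reProdIm (Metric.isBounded_Ioo _ _)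
  have hUo : IsOpen U := isOpen_Ioo.reProdIm isOpen_Ioo
  have hz : z ∈ closure U := by
    refine subset_closure ⟨abs_lt.1 ?_, abs_lt.1 ?_⟩
    · exact ((Complex.abs_re_le_norm z).trans_lt (by linarith))
    · exact ((Complex.abs_im_le_norm z).trans_lt (by linarith))
  refine Complex.norm_le_of_forall_mem_frontier_norm_le hUb hh.diffContOnCl (fun w hw => ?_) hz
  rw [hUo.frontier_eq, hU, Complex.closure_reProdIm, closure_Ioo (by linarith),
    closure_Ioo (by linarith)] at hw
  obtain ⟨⟨hw1, hw2⟩, hw3⟩ := hw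
  have hw1' : |w.re| ≤ X := abs_le.2 hw1
  have hw2' : |w.im| ≤ N := abs_le.2 hw2
  by_cases him : |w.im| = N
  · exact hK w (Or.inr (him ▸ hN1)) (hNr.trans (him ▸ Complex.abs_im_le_norm w))
  · have hre : |w.re| = X := by
      refine le_antisymm hw1' (not_lt.1 fun hlt => hw3 ⟨abs_lt.1 hlt, abs_lt.1 ?_⟩)
      exact lt_of_le_of_ne hw2' him
    refine hK w (Or.inl ?_) (hNr.trans (hXN.trans (hre ▸ Complex.abs_re_le_norm w)))
    rw [← Real.cos_abs, hre, hX, add_comm, Real.cos_add_nat_mul_pi, Real.cos_pi_div_three, mul_pow,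
      ← pow_mul, mul_comm N 2, pow_mul]
    norm_num

lemma I_mul_mem_farRegion {τ : ℝ} (hτ : 1 ≤ τ) : Complex.I * τ ∈ farRegion := by
  right
  simpa using hτ.trans (le_abs_self τ)

lemma not_eventually_eq_zero {g : ℂ → ℂ} (hg : Differentiable ℂ g) {w : ℂ} (hw : g w ≠ 0) (z : ℂ) :
    ¬ ∀ᶠ w in 𝓝 z, g w = 0 := fun h => hw <| by
  have han : AnalyticOnNhd ℂ g univ := fun z _ => hg.analyticAt z
  exact han.eqOn_zero_of_preconnected_of_eventuallyEq_zero isPreconnected_univ (mem_univ z) h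
    (mem_univ w)

/-- A uniqueness theorem of Phragmén–Lindelöf type. -/
lemma eq_zero_of_norm_le_on_farRegion {f g : ℂ → ℂ} (hf : Differentiable ℂ f)
    (hg : Differentiable ℂ g) (hO : ∀ z, f =O[𝓝 z] g) {K r : ℝ}
    (hne : ∀ z ∈ farRegion, r ≤ ‖z‖ → g z ≠ 0)
    (hK : ∀ z ∈ farRegion, r ≤ ‖z‖ → ‖f z‖ ≤ K * ‖g z‖)
    (hlim : Tendsto (fun τ : ℝ => f (Complex.I * τ) / g (Complex.I * τ)) atTop (𝓝 0)) (z : ℂ) :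
    f z = 0 := by
  have hnorm : ∀ τ : ℝ, max 1 r ≤ τ → r ≤ ‖Complex.I * (τ : ℂ)‖ := fun τ hτ => by
    have : r ≤ |τ| := ((le_max_right _ _).trans hτ).trans (le_abs_self τ)
    simpa using this
  have hgI : ∀ τ : ℝ, max 1 r ≤ τ → g (Complex.I * τ) ≠ 0 := fun τ hτ =>
    hne _ (I_mul_mem_farRegion ((le_max_left _ _).trans hτ)) (hnorm τ hτ)
  obtain ⟨h, hh, hfh⟩ := exists_differentiable_eq_mul hf hg
    (not_eventually_eq_zero hg (hgI _ le_rfl)) hO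
  have hbd := norm_le_of_norm_le_on_farRegion hh (K := K) (r := r) fun w hw hr => by
    have := hK w hw hr
    rw [hfh, norm_mul] at this
    exact le_of_mul_le_mul_right this (norm_pos_iff.2 (hne w hw hr))
  -- Liouville's theorem; the constant is then read off along the imaginary axis.
  have hconst : ∀ w, h w = h 0 := fun w => hh.apply_eq_apply_of_bounded
    (isBounded_iff_forall_norm_le.2 ⟨K, by rintro _ ⟨w, rfl⟩; exact hbd w⟩) w 0
  have h0 : h 0 = 0 := by
    refine tendsto_nhds_unique (tendsto_const_nhds.congr' ?_) hlim
    filter_upwards [eventually_ge_atTop (max 1 r)] with τ hτ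
    rw [hfh, mul_div_assoc, div_self (hgI τ hτ), mul_one, hconst (Complex.I * τ)]
  rw [hfh, hconst, h0, zero_mul]

/-! ### Bounds for trigonometric functions -/

lemma norm_cos_le (z : ℂ) : ‖Complex.cos z‖ ≤ Real.exp |z.im| := by
  rw [Complex.cos, norm_div]
  have h1 : ‖Complex.exp (z * Complex.I)‖ ≤ Real.exp |z.im| := by
    rw [Complex.norm_exp]; exact Real.exp_le_exp.2 (by simpa using neg_le_abs z.im)
  have h2 : ‖Complex.exp (-z * Complex.I)‖ ≤ Real.exp |z.im| := by
    rw [Complex.norm_exp]; exact Real.exp_le_exp.2 (by simpa using le_abs_self z.im)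
  have := norm_add_le (Complex.exp (z * Complex.I)) (Complex.exp (-z * Complex.I))
  simp only [Complex.norm_ofNat]
  linarith

lemma norm_sin_le (z : ℂ) : ‖Complex.sin z‖ ≤ Real.exp |z.im| := by
  rw [Complex.sin, norm_div, norm_mul]
  have h1 : ‖Complex.exp (z * Complex.I)‖ ≤ Real.exp |z.im| := by
    rw [Complex.norm_exp]; exact Real.exp_le_exp.2 (by simpa using neg_le_abs z.im)
  have h2 : ‖Complex.exp (-z * Complex.I)‖ ≤ Real.exp |z.im| := by
    rw [Complex.norm_exp]; exact Real.exp_le_exp.2 (by simpa using le_abs_self z.im)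
  have := norm_sub_le (Complex.exp (-z * Complex.I)) (Complex.exp (z * Complex.I))
  simp only [Complex.norm_ofNat, Complex.norm_I]
  linarith

lemma norm_cos_sq (z : ℂ) : ‖Complex.cos z‖ ^ 2 =
    Real.cos z.re ^ 2 * Real.cosh z.im ^ 2 + Real.sin z.re ^ 2 * Real.sinh z.im ^ 2 := by
  rw [Complex.sq_norm, Complex.cos_eq, ← Complex.ofReal_cos, ← Complex.ofReal_sin,
    ← Complex.ofReal_cosh, ← Complex.ofReal_sinh, Complex.normSq_apply]
  simp [-Complex.ofReal_cos, -Complex.ofReal_sin, -Complex.ofReal_cosh, -Complex.ofReal_sinh]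
  ring

lemma norm_sin_sq (z : ℂ) : ‖Complex.sin z‖ ^ 2 =
    Real.sin z.re ^ 2 * Real.cosh z.im ^ 2 + Real.cos z.re ^ 2 * Real.sinh z.im ^ 2 := by
  rw [Complex.sq_norm, Complex.sin_eq, ← Complex.ofReal_cos, ← Complex.ofReal_sin,
    ← Complex.ofReal_cosh, ← Complex.ofReal_sinh, Complex.normSq_apply]
  simp [-Complex.ofReal_cos, -Complex.ofReal_sin, -Complex.ofReal_cosh, -Complex.ofReal_sinh]
  ring

lemma exp_abs_le_two_mul_cosh (y : ℝ) : Real.exp |y| ≤ 2 * Real.cosh y := by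
  rw [← Real.cosh_abs, Real.cosh_eq]
  have := Real.exp_pos (-|y|)
  linarith

lemma exp_abs_le_four_mul_sinh {y : ℝ} (hy : 1 ≤ |y|) : Real.exp |y| ≤ 4 * Real.sinh |y| := by
  have h1 : 2 ≤ Real.exp |y| := by linarith [Real.add_one_le_exp |y|]
  have h2 : Real.exp (-|y|) ≤ 1 := Real.exp_le_one_iff.2 (by linarith)
  rw [Real.sinh_eq]; linarith

lemma sq_sinh_abs (y : ℝ) : Real.sinh |y| ^ 2 = Real.sinh y ^ 2 := by
  rcases abs_choice y with h | h <;> rw [h]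
  rw [Real.sinh_neg]; ring

lemma sin_sq_eq_of_mem {x : ℝ} (h : Real.cos x ^ 2 = 1 / 4) : Real.sin x ^ 2 = 3 / 4 := by
  have := Real.sin_sq_add_cos_sq x
  linarith

lemma exp_le_norm_cos {z : ℂ} (hz : z ∈ farRegion) : Real.exp |z.im| / 4 ≤ ‖Complex.cos z‖ := by
  refine le_of_sq_le_sq ?_ (norm_nonneg _)
  rw [norm_cos_sq]
  have hE := Real.exp_pos |z.im|
  rcases hz with h | h
  · have := exp_abs_le_two_mul_cosh z.im
    rw [h, sin_sq_eq_of_mem h]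
    nlinarith [sq_nonneg (Real.sinh z.im)]
  · have := exp_abs_le_four_mul_sinh h
    have e := Real.cosh_sq z.im
    have e1 := sq_sinh_abs z.im
    have e2 := Real.sin_sq_add_cos_sq z.re
    rw [e]
    have : (Real.exp |z.im| / 4) ^ 2 ≤ Real.sinh z.im ^ 2 := by
      rw [← e1]; gcongr; linarith
    nlinarith [sq_nonneg (Real.cos z.re)]

lemma exp_le_norm_sin {z : ℂ} (hz : z ∈ farRegion) : Real.exp |z.im| / 4 ≤ ‖Complex.sin z‖ := by
  refine le_of_sq_le_sq ?_ (norm_nonneg _)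
  rw [norm_sin_sq]
  have hE := Real.exp_pos |z.im|
  rcases hz with h | h
  · have := exp_abs_le_two_mul_cosh z.im
    rw [h, sin_sq_eq_of_mem h]
    nlinarith [sq_nonneg (Real.sinh z.im)]
  · have := exp_abs_le_four_mul_sinh h
    have e := Real.cosh_sq z.im
    have e1 := sq_sinh_abs z.im
    have e2 := Real.sin_sq_add_cos_sq z.re
    rw [e]
    have : (Real.exp |z.im| / 4) ^ 2 ≤ Real.sinh z.im ^ 2 := by
      rw [← e1]; gcongr; linarith
    nlinarith [sq_nonneg (Real.sin z.re)]

/-- The zeros satisfy `cos² z = n / (n + 1) ∈ [1/2, 1)`. The lines `cos² (Re z) = 1/4` stay away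
from these as well as from the zeros of `cos` and `sin`, uniformly in `n`. -/
lemma exp_sq_le_norm_cos_sq_sub {z : ℂ} (hz : z ∈ farRegion) {n : ℕ} (hn : 1 ≤ n) :
    Real.exp |z.im| ^ 2 / 16 ≤ ‖Complex.cos z ^ 2 - n * Complex.sin z ^ 2‖ := by
  have hn' : (1 : ℝ) ≤ n := by exact_mod_cast hn
  have e0 : Complex.cos z ^ 2 - n * Complex.sin z ^ 2 = (n + 1) * Complex.cos z ^ 2 - n := by
    rw [Complex.sin_sq]; ring
  rw [e0]
  have e := Real.cosh_sq z.im
  have hE := Real.exp_pos |z.im|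
  rcases hz with h | h
  · have h1 := exp_abs_le_two_mul_cosh z.im
    have hre : ((n + 1) * Complex.cos z ^ 2 - n : ℂ).re =
        (n + 1) * (Real.cos z.re ^ 2 * Real.cosh z.im ^ 2 -
          Real.sin z.re ^ 2 * Real.sinh z.im ^ 2) - n := by
      rw [Complex.cos_eq, ← Complex.ofReal_cos, ← Complex.ofReal_sin,
        ← Complex.ofReal_cosh, ← Complex.ofReal_sinh]
      simp [-Complex.ofReal_cos, -Complex.ofReal_sin, -Complex.ofReal_cosh, -Complex.ofReal_sinh,
        pow_two]
      ring_nf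
      simp
    refine le_trans ?_ (Complex.abs_re_le_norm _)
    rw [hre, h, sin_sq_eq_of_mem h]
    -- On these lines the real part is `-((n + 1) cosh² y / 2 + (n - 3) / 4)`, which is negative
    -- because `cosh² y ≥ 1` and `n ≥ 1`.
    refine le_trans ?_ (neg_le_abs _)
    have h2 : Real.exp |z.im| ^ 2 ≤ 4 * Real.cosh z.im ^ 2 := by nlinarith
    have h3 : 1 ≤ Real.cosh z.im ^ 2 := by rw [e]; nlinarith [sq_nonneg (Real.sinh z.im)]
    nlinarith
  · have h1 := exp_abs_le_four_mul_sinh h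
    have e1 := sq_sinh_abs z.im
    have e2 := Real.sin_sq_add_cos_sq z.re
    have hs : Real.sinh z.im ^ 2 ≤ ‖Complex.cos z‖ ^ 2 := by
      rw [norm_cos_sq, e]; nlinarith [sq_nonneg (Real.cos z.re)]
    have hs1 : 1 ≤ Real.sinh z.im ^ 2 := by
      rw [← e1]
      have : |z.im| ≤ Real.sinh |z.im| := Real.self_le_sinh_iff.2 (abs_nonneg _)
      nlinarith
    have hs2 : (Real.exp |z.im| / 4) ^ 2 ≤ Real.sinh z.im ^ 2 := by
      rw [← e1]; gcongr; linarith
    have h3 := norm_sub_norm_le ((n + 1) * Complex.cos z ^ 2 : ℂ) n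
    have h4 : ‖((n + 1) * Complex.cos z ^ 2 : ℂ)‖ = (n + 1) * ‖Complex.cos z‖ ^ 2 := by
      rw [norm_mul, norm_pow, ← Nat.cast_succ, Complex.norm_natCast, Nat.cast_succ]
    rw [h4, Complex.norm_natCast] at h3
    nlinarith

/-! ### Analyticity of the characteristic function -/

/-- Differentiation under the integral sign, with the derivative of the kernel dominated by Cauchy's
estimate on unit circles inside the ball of radius `2`. -/
lemma differentiable_integral_mul {K : ℂ → ℝ → ℂ} (hK : Continuous (Function.uncurry K))
    (hd : ∀ t, Differentiable ℂ fun ρ => K ρ t) {g : ℝ → ℂ}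
    (hg : IntervalIntegrable g volume 0 1) :
    Differentiable ℂ fun ρ => ∫ t in (0 : ℝ)..1, K ρ t * g t := by
  intro ρ₀
  obtain ⟨M, hM⟩ := ((isCompact_closedBall ρ₀ 2).prod
    (isCompact_Icc (a := (0 : ℝ)) (b := 1))).exists_bound_of_continuousOn hK.continuousOn
  have hKc : ∀ ρ, Continuous (K ρ) := fun ρ => hK.comp (by fun_prop : Continuous fun t => (ρ, t))
  have hint : ∀ ρ, IntervalIntegrable (fun t => K ρ t * g t) volume 0 1 := fun ρ =>
    hg.continuousOn_mul (hKc ρ).continuousOn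
  have hdK : ∀ t ∈ uIoc (0 : ℝ) 1, ∀ ρ ∈ Metric.ball ρ₀ 1, ‖deriv (fun ρ => K ρ t) ρ‖ ≤ M := by
    intro t ht ρ hρ
    rw [uIoc_of_le zero_le_one] at ht
    have := Complex.norm_deriv_le_of_forall_mem_sphere_norm_le (c := ρ) (R := 1) (C := M)
      (f := fun ρ => K ρ t) one_pos (hd t).diffContOnCl fun z hz => hM (z, t)
        ⟨?_, Ioc_subset_Icc_self ht⟩
    · simpa using this
    · rw [Metric.mem_closedBall]
      rw [Metric.mem_sphere] at hz
      rw [Metric.mem_ball] at hρ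
      linarith [dist_triangle z ρ ρ₀]
  have hmeas : AEStronglyMeasurable (fun t => deriv (fun ρ => K ρ t) ρ₀)
      (volume.restrict (uIoc (0 : ℝ) 1)) := by
    -- The derivative of the kernel is a pointwise limit of continuous difference quotients.
    refine aestronglyMeasurable_of_tendsto_ae atTop
      (f := fun (k : ℕ) t => ((k + 1 : ℂ)⁻¹)⁻¹ • (K (ρ₀ + (k + 1 : ℂ)⁻¹) t - K ρ₀ t)) ?_ ?_
    · intro k
      have h1 := hKc (ρ₀ + (k + 1 : ℂ)⁻¹)
      have h2 := hKc ρ₀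
      exact Continuous.aestronglyMeasurable (by fun_prop)
    · refine Eventually.of_forall fun t => ?_
      have h1 := (hasDerivAt_iff_tendsto_slope_zero.1 (hd t ρ₀).hasDerivAt)
      refine h1.comp (tendsto_nhdsWithin_iff.2 ⟨?_, Eventually.of_forall fun k => ?_⟩)
      · have := tendsto_one_div_add_atTop_nhds_zero_nat (𝕜 := ℂ)
        simpa using this
      · simpa using Nat.cast_add_one_ne_zero (R := ℂ) k
  refine (intervalIntegral.hasDerivAt_integral_of_dominated_loc_of_deriv_le
    (F' := fun ρ t => deriv (fun ρ => K ρ t) ρ * g t) (bound := fun t => M * ‖g t‖)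
    (Metric.ball_mem_nhds ρ₀ one_pos) (Eventually.of_forall fun ρ => ?_) (hint ρ₀) ?_ ?_
    (hg.norm.const_mul M) ?_).2.differentiableAt
  · exact (intervalIntegrable_iff.1 (hint ρ)).aestronglyMeasurable
  · exact hmeas.mul (intervalIntegrable_iff.1 hg).aestronglyMeasurable
  · refine Eventually.of_forall fun t ht ρ hρ => ?_
    rw [norm_mul]
    exact mul_le_mul_of_nonneg_right (hdK t ht ρ hρ) (norm_nonneg _)
  · exact Eventually.of_forall fun t _ ρ _ => (hd t ρ).hasDerivAt.mul_const _

@[fun_prop]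
lemma differentiable_psi (h : ℂ) (x : ℝ) : Differentiable ℂ fun ρ => psi h ρ x := by
  unfold psi; fun_prop

@[fun_prop]
lemma differentiable_dpsi (h : ℂ) (x : ℝ) : Differentiable ℂ fun ρ => dpsi h ρ x := by
  unfold dpsi; fun_prop

@[fun_prop]
lemma differentiable_phi (ν : Fin 2) (x : ℝ) : Differentiable ℂ fun ρ => phi ν ρ x := by
  unfold phi; split_ifs <;> fun_prop

@[fun_prop]
lemma differentiable_dphi (ν : Fin 2) (x : ℝ) : Differentiable ℂ fun ρ => dphi ν ρ x := by
  unfold dphi; split_ifs <;> fun_prop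

lemma differentiable_potInt (a : ℝ) {q : ℝ → ℂ} (hq : IntervalIntegrable q volume 0 1) (h : ℂ)
    (ν : Fin 2) : Differentiable ℂ fun ρ => potInt a q h ν ρ :=
  differentiable_integral_mul (K := fun ρ t => psi h ρ (1 - t) * phi ν ρ (t - a + 1))
    (by fun_prop) (fun t => by fun_prop) hq

lemma differentiable_charFn {n : ℕ} (a : ℝ) {q : GraphFun n}
    (hq : ∀ j : Fin n, IntervalIntegrable (q j.succ) volume 0 1) (H : Fin n → ℂ) (ν : Fin 2) :
    Differentiable ℂ fun ρ => charFn a q H ν ρ := by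
  have := fun j => differentiable_potInt a (hq j) (H j) ν
  unfold charFn
  fun_prop

/-! ### Bounds for the characteristic function -/

/-- The weight `|ρ|⁻¹` for `ν = 0` and `1` for `ν = 1`, the size of `phi ν ρ`. -/
def weight (ν : Fin 2) (ρ : ℂ) : ℝ := if ν = 0 then ‖ρ‖⁻¹ else 1

lemma weight_pos (ν : Fin 2) {ρ : ℂ} (hρ : 1 ≤ ‖ρ‖) : 0 < weight ν ρ := by
  unfold weight; split_ifs <;> positivity

lemma im_mul_ofReal_abs (ρ : ℂ) {x : ℝ} (hx : 0 ≤ x) : |(ρ * x).im| = |ρ.im| * x := by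
  rw [Complex.im_mul_ofReal, abs_mul, abs_of_nonneg hx]

lemma norm_cosq_le (ρ : ℂ) {x : ℝ} (hx : 0 ≤ x) : ‖cosq ρ x‖ ≤ Real.exp (|ρ.im| * x) := by
  rw [← im_mul_ofReal_abs ρ hx]; exact norm_cos_le _

lemma norm_sinq_le {ρ : ℂ} (hρ : 1 ≤ ‖ρ‖) {x : ℝ} (hx : 0 ≤ x) :
    ‖sinq ρ x‖ ≤ ‖ρ‖⁻¹ * Real.exp (|ρ.im| * x) := by
  have hρ0 : ρ ≠ 0 := norm_pos_iff.1 (by linarith)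
  rw [sinq_eq_div hρ0, norm_div, div_eq_inv_mul, ← im_mul_ofReal_abs ρ hx]
  exact mul_le_mul_of_nonneg_left (norm_sin_le _) (by positivity)

lemma norm_phi_le (ν : Fin 2) {ρ : ℂ} (hρ : 1 ≤ ‖ρ‖) {x : ℝ} (hx : 0 ≤ x) :
    ‖phi ν ρ x‖ ≤ weight ν ρ * Real.exp (|ρ.im| * x) := by
  unfold phi weight
  split_ifs
  · exact norm_sinq_le hρ hx
  · simpa using norm_cosq_le ρ hx

lemma norm_psi_le (h : ℂ) {ρ : ℂ} (hρ : 1 ≤ ‖ρ‖) {x : ℝ} (hx : 0 ≤ x) :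
    ‖psi h ρ x‖ ≤ (1 + ‖h‖) * Real.exp (|ρ.im| * x) := by
  have h1 := norm_cosq_le ρ hx
  have h2 : ‖sinq ρ x‖ ≤ Real.exp (|ρ.im| * x) := (norm_sinq_le hρ hx).trans
    (mul_le_of_le_one_left (Real.exp_pos _).le (inv_le_one_of_one_le₀ hρ))
  calc ‖psi h ρ x‖ ≤ ‖cosq ρ x‖ + ‖h‖ * ‖sinq ρ x‖ := by
        rw [psi, ← norm_mul]; exact norm_add_le _ _
    _ ≤ _ := by
        have := mul_le_mul_of_nonneg_left h2 (norm_nonneg h)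
        linarith

/-- The arguments `1 - t` and `t - a + 1` add up to `2 - a ≤ 1`, so the exponential growth is at
most that of one factor `psi`. The second argument is nonnegative wherever `q` is not known to
vanish. -/
lemma norm_potInt_le {a : ℝ} (ha : 1 ≤ a) {q : ℝ → ℂ} (hq : IntervalIntegrable q volume 0 1)
    (hq0 : ∀ᵐ x : ℝ, x ∈ Ioo 0 (a - 1) → q x = 0) (h : ℂ) (ν : Fin 2) {ρ : ℂ} (hρ : 1 ≤ ‖ρ‖) :
    ‖potInt a q h ν ρ‖ ≤
      weight ν ρ * Real.exp |ρ.im| * ((1 + ‖h‖) * ∫ t in (0 : ℝ)..1, ‖q t‖) := by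
  have hw := weight_pos ν hρ
  calc ‖potInt a q h ν ρ‖
      ≤ ∫ t in (0 : ℝ)..1, (weight ν ρ * Real.exp |ρ.im| * (1 + ‖h‖)) * ‖q t‖ := by
        refine intervalIntegral.norm_integral_le_of_norm_le zero_le_one ?_ (hq.norm.const_mul _)
        filter_upwards [hq0] with t ht htI
        by_cases hta : t < a - 1
        · simp [ht ⟨htI.1, hta⟩]
        · rw [norm_mul, norm_mul]
          refine mul_le_mul_of_nonneg_right ?_ (norm_nonneg _)
          calc _ ≤ ((1 + ‖h‖) * Real.exp (|ρ.im| * (1 - t))) *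
                (weight ν ρ * Real.exp (|ρ.im| * (t - a + 1))) :=
                mul_le_mul (norm_psi_le h hρ (by linarith [htI.2]))
                  (norm_phi_le ν hρ (by linarith)) (norm_nonneg _) (by positivity)
            _ = weight ν ρ * Real.exp (|ρ.im| * (2 - a)) * (1 + ‖h‖) := by
                rw [show |ρ.im| * (2 - a) = |ρ.im| * (1 - t) + |ρ.im| * (t - a + 1) by ring,
                  Real.exp_add]
                ring
            _ ≤ _ := by
                have : |ρ.im| * (2 - a) ≤ |ρ.im| := by nlinarith [abs_nonneg ρ.im]
                gcongr
    _ = _ := by rw [intervalIntegral.integral_const_mul]; ring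

/-- `cos ρ` contributes at least `exp |Im ρ| / 4`, and the condition `8 ‖h‖ ≤ ‖ρ‖` keeps the Robin
correction below half of that. -/
lemma le_norm_psi_one {h ρ : ℂ} (hρ : ρ ∈ farRegion) (hr : 1 ≤ ‖ρ‖) (hh : 8 * ‖h‖ ≤ ‖ρ‖) :
    Real.exp |ρ.im| / 8 ≤ ‖psi h ρ 1‖ := by
  have h1 := exp_le_norm_cos hρ
  have h2 : ‖h * sinq ρ 1‖ ≤ Real.exp |ρ.im| / 8 := by
    have h3 := norm_sinq_le hr zero_le_one
    rw [mul_one] at h3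
    rw [norm_mul]
    calc ‖h‖ * ‖sinq ρ 1‖ ≤ (‖ρ‖ / 8) * (‖ρ‖⁻¹ * Real.exp |ρ.im|) := by
          gcongr; linarith
      _ = _ := by field_simp
  have h4 := norm_sub_le (psi h ρ 1) (h * sinq ρ 1)
  have h5 : psi h ρ 1 - h * sinq ρ 1 = Complex.cos ρ := by
    rw [psi, add_sub_cancel_right, cosq]; simp
  rw [h5] at h4
  linarith

lemma psi_one_ne_zero {h ρ : ℂ} (hρ : ρ ∈ farRegion) (hr : 1 ≤ ‖ρ‖) (hh : 8 * ‖h‖ ≤ ‖ρ‖) :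
    psi h ρ 1 ≠ 0 :=
  norm_pos_iff.1 ((by positivity : (0 : ℝ) < Real.exp |ρ.im| / 8).trans_le
    (le_norm_psi_one hρ hr hh))

lemma cos_ne_zero_of_mem {ρ : ℂ} (hρ : ρ ∈ farRegion) : Complex.cos ρ ≠ 0 :=
  norm_pos_iff.1 ((by positivity : (0 : ℝ) < Real.exp |ρ.im| / 4).trans_le (exp_le_norm_cos hρ))

/-- This isolates the `h`-independent leading term `-ρ tan ρ`; the Pythagorean identity collapses
the numerator of the remainder to `h`. -/
lemma dpsi_div_psi {h ρ : ℂ} (hc : Complex.cos ρ ≠ 0) (hp : psi h ρ 1 ≠ 0) :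
    dpsi h ρ 1 / psi h ρ 1 =
      -ρ * Complex.sin ρ / Complex.cos ρ + h / (Complex.cos ρ * psi h ρ 1) := by
  have h1 : cosq ρ 1 = Complex.cos ρ := by simp [cosq]
  have h2 : ρ * sinq ρ 1 = Complex.sin ρ := by rw [mul_sinq]; simp
  have h3 := cosq_sq_add ρ 1
  field_simp
  rw [← h2, ← h1, psi, dpsi]
  linear_combination h * h3

section Bounds

variable {n : ℕ} {a : ℝ} {q : GraphFun n} {H : Fin n → ℂ}

lemma charFn_eq_prod_mul {ν : Fin 2} {ρ : ℂ} (hp : ∀ k, psi (H k) ρ 1 ≠ 0) :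
    charFn a q H ν ρ = (∏ k, psi (H k) ρ 1) * (dphi ν ρ 1 +
      ∑ j, (phi ν ρ 1 * dpsi (H j) ρ 1 + potInt a (q j.succ) (H j) ν ρ) / psi (H j) ρ 1) := by
  rw [charFn, mul_add, Finset.mul_sum, mul_comm (dphi ν ρ 1)]
  congr 1
  refine Finset.sum_congr rfl fun j _ => ?_
  rw [← Finset.mul_prod_erase _ _ (Finset.mem_univ j)]
  have := hp j
  field_simp

/-- The leading part of `charFn` divided by the product of all `psi`: it equals `(cos² ρ - n sin² ρ)
/ cos ρ` for `ν = 0` and `-(n + 1) ρ sin ρ` for `ν = 1`. -/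
lemma le_norm_dphi_sub (hn : 1 ≤ n) (ν : Fin 2) {ρ : ℂ} (hρ : ρ ∈ farRegion) (hr : 1 ≤ ‖ρ‖) :
    weight ν ρ * ‖ρ‖ * (Real.exp |ρ.im| / 16) ≤
      ‖dphi ν ρ 1 - n * (ρ * Complex.sin ρ / Complex.cos ρ) * phi ν ρ 1‖ := by
  have hc := cos_ne_zero_of_mem hρ
  have h1 : cosq ρ 1 = Complex.cos ρ := by simp [cosq]
  have h2 : ρ * sinq ρ 1 = Complex.sin ρ := by rw [mul_sinq]; simp
  unfold dphi phi weight
  split_ifs with h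
  · have e : cosq ρ 1 - n * (ρ * Complex.sin ρ / Complex.cos ρ) * sinq ρ 1 =
        (Complex.cos ρ ^ 2 - n * Complex.sin ρ ^ 2) / Complex.cos ρ := by
      rw [h1]
      field_simp
      rw [← h2]; ring
    rw [e, norm_div, le_div_iff₀ (norm_pos_iff.2 hc), inv_mul_cancel₀ (by linarith), one_mul]
    refine le_trans ?_ (exp_sq_le_norm_cos_sq_sub hρ hn)
    have := norm_cos_le ρ
    nlinarith [Real.exp_pos |ρ.im|]
  · have e : -ρ ^ 2 * sinq ρ 1 - n * (ρ * Complex.sin ρ / Complex.cos ρ) * cosq ρ 1 =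
        -((n + 1 : ℕ) : ℂ) * (ρ * Complex.sin ρ) := by
      rw [h1]
      push_cast
      field_simp
      rw [← h2]; ring
    rw [e, norm_mul, norm_neg, Complex.norm_natCast, norm_mul, one_mul]
    have h3 := exp_le_norm_sin hρ
    have h4 : (1 : ℝ) ≤ ((n + 1 : ℕ) : ℝ) := by exact_mod_cast Nat.le_add_left 1 n
    have h5 : ‖ρ‖ * (Real.exp |ρ.im| / 16) ≤ ‖ρ‖ * ‖Complex.sin ρ‖ := by
      gcongr
      linarith [Real.exp_pos |ρ.im|]
    nlinarith [mul_nonneg (norm_nonneg ρ) (norm_nonneg (Complex.sin ρ))]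

/-- After division by the product of the `psi`, the Robin coefficients and potentials contribute
terms smaller than the leading part by a factor of order `1 / ‖ρ‖`; far out they consume at most
half of it. -/
lemma exists_le_norm_charFn (hn : 1 ≤ n) (ha : 1 ≤ a)
    (hq : ∀ j : Fin n, IntervalIntegrable (q j.succ) volume 0 1)
    (hq0 : ∀ j : Fin n, ∀ᵐ x : ℝ, x ∈ Ioo 0 (a - 1) → q j.succ x = 0) (ν : Fin 2) :
    ∃ r, 1 ≤ r ∧ (∀ j, 8 * ‖H j‖ ≤ r) ∧ ∀ ρ ∈ farRegion, r ≤ ‖ρ‖ →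
      ‖∏ k, psi (H k) ρ 1‖ * (weight ν ρ * ‖ρ‖ * (Real.exp |ρ.im| / 32)) ≤ ‖charFn a q H ν ρ‖ := by
  -- The `32 = 4 · 8` comes from the lower bounds `exp / 4` for `cos` and `exp / 8` for `psi`, the
  -- other `8` from `psi` alone. The radius below makes `∑ c ≤ ‖ρ‖ / 32`, half of the leading
  -- constant `1/16`.
  set c : Fin n → ℝ := fun j => 32 * ‖H j‖ + 8 * ((1 + ‖H j‖) * ∫ t in (0 : ℝ)..1, ‖q j.succ t‖)
    with hc
  have hI : ∀ j : Fin n, 0 ≤ ∫ t in (0 : ℝ)..1, ‖q j.succ t‖ := fun j =>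
    intervalIntegral.integral_nonneg zero_le_one fun t _ => norm_nonneg _
  have hc0 : ∀ j, 0 ≤ c j := fun j => by have := hI j; positivity
  have hH0 : 0 ≤ ∑ j, 8 * ‖H j‖ := Finset.sum_nonneg fun j _ => by positivity
  have hcs : 0 ≤ ∑ j, c j := Finset.sum_nonneg fun j _ => hc0 j
  have hHle : ∀ j, 8 * ‖H j‖ ≤ 1 + ∑ j, 8 * ‖H j‖ + 32 * ∑ j, c j := fun j => by
    have := Finset.single_le_sum (f := fun j => 8 * ‖H j‖) (fun j _ => by positivity)
      (Finset.mem_univ j)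
    linarith
  refine ⟨1 + ∑ j, 8 * ‖H j‖ + 32 * ∑ j, c j, by linarith, hHle, fun ρ hρ hr => ?_⟩
  have hr1 : 1 ≤ ‖ρ‖ := by linarith
  have hr2 : 32 * ∑ j, c j ≤ ‖ρ‖ := by linarith
  have hw := weight_pos ν hr1
  have hp : ∀ k, psi (H k) ρ 1 ≠ 0 := fun k => psi_one_ne_zero hρ hr1 ((hHle k).trans hr)
  have hpl : ∀ k, Real.exp |ρ.im| / 8 ≤ ‖psi (H k) ρ 1‖ := fun k =>
    le_norm_psi_one hρ hr1 ((hHle k).trans hr)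
  have hcos := cos_ne_zero_of_mem hρ
  have hE : 1 ≤ Real.exp |ρ.im| := Real.one_le_exp (abs_nonneg _)
  rw [charFn_eq_prod_mul hp, norm_mul]
  refine mul_le_mul_of_nonneg_left ?_ (norm_nonneg _)
  set err : Fin n → ℂ := fun j => phi ν ρ 1 * (H j / (Complex.cos ρ * psi (H j) ρ 1)) +
    potInt a (q j.succ) (H j) ν ρ / psi (H j) ρ 1 with herr
  have hsplit : dphi ν ρ 1 +
      ∑ j, (phi ν ρ 1 * dpsi (H j) ρ 1 + potInt a (q j.succ) (H j) ν ρ) / psi (H j) ρ 1 =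
      (dphi ν ρ 1 - n * (ρ * Complex.sin ρ / Complex.cos ρ) * phi ν ρ 1) + ∑ j, err j := by
    have : ∀ j, (phi ν ρ 1 * dpsi (H j) ρ 1 + potInt a (q j.succ) (H j) ν ρ) / psi (H j) ρ 1 =
        -(ρ * Complex.sin ρ / Complex.cos ρ) * phi ν ρ 1 + err j := fun j => by
      rw [add_div, mul_div_assoc, dpsi_div_psi hcos (hp j), herr]; ring
    rw [Finset.sum_congr rfl fun j _ => this j, Finset.sum_add_distrib, Finset.sum_const,
      Finset.card_univ, Fintype.card_fin, nsmul_eq_mul]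
    ring
  have herrle : ∀ j, ‖err j‖ ≤ weight ν ρ * Real.exp |ρ.im| * c j := fun j => by
    have h1 : ‖phi ν ρ 1 * (H j / (Complex.cos ρ * psi (H j) ρ 1))‖ ≤
        weight ν ρ * Real.exp |ρ.im| * (32 * ‖H j‖) := by
      rw [norm_mul, norm_div, norm_mul]
      have h2 := norm_phi_le ν hr1 zero_le_one
      rw [mul_one] at h2
      refine mul_le_mul h2 ?_ (by positivity) (by positivity)
      rw [div_le_iff₀ (mul_pos (norm_pos_iff.2 hcos) (norm_pos_iff.2 (hp j)))]
      have h3 : (1 : ℝ) / 4 * (1 / 8) ≤ ‖Complex.cos ρ‖ * ‖psi (H j) ρ 1‖ :=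
        mul_le_mul ((by linarith : (1 : ℝ) / 4 ≤ Real.exp |ρ.im| / 4).trans (exp_le_norm_cos hρ))
          ((by linarith : (1 : ℝ) / 8 ≤ Real.exp |ρ.im| / 8).trans (hpl j)) (by norm_num)
          (norm_nonneg _)
      nlinarith [norm_nonneg (H j)]
    have h4 : ‖potInt a (q j.succ) (H j) ν ρ / psi (H j) ρ 1‖ ≤ weight ν ρ * Real.exp |ρ.im| *
        (8 * ((1 + ‖H j‖) * ∫ t in (0 : ℝ)..1, ‖q j.succ t‖)) := by
      rw [norm_div, div_le_iff₀ (norm_pos_iff.2 (hp j))]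
      refine (norm_potInt_le ha (hq j) (hq0 j) (H j) ν hr1).trans ?_
      have h5 : (1 : ℝ) ≤ 8 * ‖psi (H j) ρ 1‖ := by linarith [hpl j]
      have h6 : 0 ≤ weight ν ρ * Real.exp |ρ.im| * ((1 + ‖H j‖) *
        ∫ t in (0 : ℝ)..1, ‖q j.succ t‖) := by have := hI j; positivity
      nlinarith
    refine (norm_add_le _ _).trans ((add_le_add h1 h4).trans (le_of_eq ?_))
    rw [hc]; ring
  have hsum : ‖∑ j, err j‖ ≤ weight ν ρ * Real.exp |ρ.im| * ∑ j, c j := by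
    rw [Finset.mul_sum]
    exact (norm_sum_le _ _).trans (Finset.sum_le_sum fun j _ => herrle j)
  have hmain := le_norm_dphi_sub hn ν hρ hr1
  rw [hsplit]
  have h7 := norm_sub_le ((dphi ν ρ 1 - n * (ρ * Complex.sin ρ / Complex.cos ρ) * phi ν ρ 1) +
    ∑ j, err j) (∑ j, err j)
  rw [add_sub_cancel_right] at h7
  have h8 : weight ν ρ * Real.exp |ρ.im| * ∑ j, c j ≤
      weight ν ρ * Real.exp |ρ.im| * (‖ρ‖ / 32) := by
    gcongr; linarith
  have h9 : weight ν ρ * ‖ρ‖ * (Real.exp |ρ.im| / 16) =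
    weight ν ρ * ‖ρ‖ * (Real.exp |ρ.im| / 32) + weight ν ρ * Real.exp |ρ.im| * (‖ρ‖ / 32) := by
    ring
  linarith

lemma charFn_sub_charFn {q' : GraphFun n} {ν : Fin 2} {ρ : ℂ} :
    charFn a q H ν ρ - charFn a q' H ν ρ =
      ∑ j, (potInt a (q j.succ) (H j) ν ρ - potInt a (q' j.succ) (H j) ν ρ) *
        ∏ k ∈ Finset.univ.erase j, psi (H k) ρ 1 := by
  rw [charFn, charFn, add_sub_add_left_eq_sub, ← Finset.sum_sub_distrib]
  exact Finset.sum_congr rfl fun j _ => by ring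

/-- The free parts cancel. In each remaining term the growth of `potInt` is absorbed by the missing
factor `psi (H j)`, so, compared with the lower bound for `charFn`, a factor `‖ρ‖` is gained. -/
lemma exists_norm_charFn_sub_le (ha : 1 ≤ a) {q' : GraphFun n}
    (hq : ∀ j : Fin n, IntervalIntegrable (q j.succ) volume 0 1)
    (hq0 : ∀ j : Fin n, ∀ᵐ x : ℝ, x ∈ Ioo 0 (a - 1) → q j.succ x = 0)
    (hq' : ∀ j : Fin n, IntervalIntegrable (q' j.succ) volume 0 1)
    (hq0' : ∀ j : Fin n, ∀ᵐ x : ℝ, x ∈ Ioo 0 (a - 1) → q' j.succ x = 0) (ν : Fin 2) :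
    ∃ C, 0 ≤ C ∧ ∀ ρ ∈ farRegion, 1 ≤ ‖ρ‖ → (∀ j, 8 * ‖H j‖ ≤ ‖ρ‖) →
      ‖charFn a q H ν ρ - charFn a q' H ν ρ‖ ≤ ‖∏ k, psi (H k) ρ 1‖ * (weight ν ρ * C) := by
  set c : Fin n → ℝ := fun j => 8 * ((1 + ‖H j‖) * (∫ t in (0 : ℝ)..1, ‖q j.succ t‖) +
    (1 + ‖H j‖) * ∫ t in (0 : ℝ)..1, ‖q' j.succ t‖) with hc
  have hc0 : ∀ j, 0 ≤ c j := fun j => by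
    have h1 : 0 ≤ ∫ t in (0 : ℝ)..1, ‖q j.succ t‖ :=
      intervalIntegral.integral_nonneg zero_le_one fun t _ => norm_nonneg _
    have h2 : 0 ≤ ∫ t in (0 : ℝ)..1, ‖q' j.succ t‖ :=
      intervalIntegral.integral_nonneg zero_le_one fun t _ => norm_nonneg _
    positivity
  refine ⟨∑ j, c j, Finset.sum_nonneg fun j _ => hc0 j, fun ρ hρ hr hH => ?_⟩
  rw [charFn_sub_charFn, Finset.mul_sum, Finset.mul_sum]
  refine (norm_sum_le _ _).trans (Finset.sum_le_sum fun j _ => ?_)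
  rw [norm_mul, ← Finset.mul_prod_erase _ _ (Finset.mem_univ j), norm_mul, mul_right_comm]
  refine mul_le_mul_of_nonneg_right ?_ (norm_nonneg _)
  have h1 := norm_potInt_le ha (hq j) (hq0 j) (H j) ν hr
  have h2 := norm_potInt_le ha (hq' j) (hq0' j) (H j) ν hr
  have h3 := le_norm_psi_one hρ hr (hH j)
  have hw := weight_pos ν hr
  calc _ ≤ _ := (norm_sub_le _ _).trans (add_le_add h1 h2)
    _ = Real.exp |ρ.im| / 8 * (weight ν ρ * c j) := by rw [hc]; ring
    _ ≤ _ := mul_le_mul_of_nonneg_right h3 (mul_nonneg hw.le (hc0 j))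

/-- The zeros with multiplicities of the characteristic functions determine them. -/
lemma charFn_eq_of_isBigO (hn : 1 ≤ n) (ha : 1 ≤ a) {q' : GraphFun n}
    (hq : ∀ j : Fin n, IntervalIntegrable (q j.succ) volume 0 1)
    (hq0 : ∀ j : Fin n, ∀ᵐ x : ℝ, x ∈ Ioo 0 (a - 1) → q j.succ x = 0)
    (hq' : ∀ j : Fin n, IntervalIntegrable (q' j.succ) volume 0 1)
    (hq0' : ∀ j : Fin n, ∀ᵐ x : ℝ, x ∈ Ioo 0 (a - 1) → q' j.succ x = 0) (ν : Fin 2)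
    (hO : ∀ z, charFn a q H ν =O[𝓝 z] charFn a q' H ν) (ρ : ℂ) :
    charFn a q H ν ρ = charFn a q' H ν ρ := by
  obtain ⟨r, hr1, hrH, hlow⟩ := exists_le_norm_charFn (H := H) hn ha hq' hq0' ν
  obtain ⟨C, hC, hup⟩ := exists_norm_charFn_sub_le (H := H) ha hq hq0 hq' hq0' ν
  have hpos : ∀ z ∈ farRegion, r ≤ ‖z‖ → 0 < ‖∏ k, psi (H k) z 1‖ := fun z hz hr =>
    norm_pos_iff.2 (Finset.prod_ne_zero_iff.2 fun k _ =>
      psi_one_ne_zero hz (hr1.trans hr) ((hrH k).trans hr))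
  have hne : ∀ z ∈ farRegion, r ≤ ‖z‖ → charFn a q' H ν z ≠ 0 := fun z hz hr => by
    have h1 := hpos z hz hr
    have h2 := weight_pos ν (hr1.trans hr)
    have h3 : 0 < ‖z‖ := by linarith
    exact norm_pos_iff.1 (lt_of_lt_of_le (by positivity) (hlow z hz hr))
  -- The factor `1 / ‖z‖` gives boundedness of the quotient and also its decay on the imaginary
  -- axis.
  have hK : ∀ z ∈ farRegion, r ≤ ‖z‖ →
      ‖charFn a q H ν z - charFn a q' H ν z‖ ≤ (32 * C / ‖z‖) * ‖charFn a q' H ν z‖ :=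
    fun z hz hr => by
    have h1 := hpos z hz hr
    have h2 := weight_pos ν (hr1.trans hr)
    have h3 : 0 < ‖z‖ := by linarith
    refine (hup z hz (hr1.trans hr) fun j => (hrH j).trans hr).trans ?_
    refine le_trans ?_ (mul_le_mul_of_nonneg_left (hlow z hz hr) (by positivity))
    have hE : 1 ≤ Real.exp |z.im| := Real.one_le_exp (abs_nonneg _)
    have e : 32 * C / ‖z‖ * (‖∏ k, psi (H k) z 1‖ * (weight ν z * ‖z‖ * (Real.exp |z.im| / 32))) =
        ‖∏ k, psi (H k) z 1‖ * (weight ν z * C) * Real.exp |z.im| := by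
      field_simp
    rw [e]
    exact le_mul_of_one_le_right (by positivity) hE
  refine sub_eq_zero.1 (eq_zero_of_norm_le_on_farRegion
    (f := fun z => charFn a q H ν z - charFn a q' H ν z)
    ((differentiable_charFn a hq H ν).sub (differentiable_charFn a hq' H ν))
    (differentiable_charFn a hq' H ν) (fun z => (hO z).sub (isBigO_refl _ _)) hne (K := 32 * C)
    (fun z hz hr => (hK z hz hr).trans ?_) ?_ ρ)
  · refine mul_le_mul_of_nonneg_right ?_ (norm_nonneg _)
    exact div_le_self (by positivity) (hr1.trans hr)
  · refine squeeze_zero_norm' (a := fun τ : ℝ => 32 * C / τ) ?_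
      (tendsto_const_nhds.div_atTop tendsto_id)
    filter_upwards [eventually_ge_atTop r] with τ hτ
    have hτ0 : 0 ≤ τ := by linarith
    have hn : ‖Complex.I * (τ : ℂ)‖ = τ := by simp [abs_of_nonneg hτ0]
    have hm := I_mul_mem_farRegion (hr1.trans hτ)
    have := hK _ hm (by rwa [hn])
    rw [hn] at this
    rw [norm_div, div_le_iff₀ (norm_pos_iff.2 (hne _ hm (by rwa [hn])))]
    exact this

end Bounds

/-! ### Uniqueness of the potential on one edge -/

/-- Parseval's identity in the form of a uniqueness theorem. -/
lemma ae_eq_zero_of_integral_exp_eq_zero {p : ℝ → ℂ}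
    (hp : MemLp p 2 (volume.restrict (Ioo (0 : ℝ) 1)))
    (h : ∀ n : ℤ, ∫ t in (0 : ℝ)..1, Complex.exp (2 * Real.pi * Complex.I * n * t) * p t = 0) :
    p =ᵐ[volume.restrict (Ioo (0 : ℝ) 1)] 0 := by
  rw [restrict_Ioo_eq_restrict_Ioc] at hp ⊢
  have h1 := tsum_sq_fourierCoeffOn zero_lt_one hp
  have h2 : ∀ i : ℤ, fourierCoeffOn zero_lt_one p i = 0 := fun i => by
    rw [fourierCoeffOn_eq_integral]
    have : (fun x : ℝ => fourier (-i) (x : AddCircle ((1 : ℝ) - 0)) • p x) =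
        fun t : ℝ => Complex.exp (2 * Real.pi * Complex.I * (-i : ℤ) * t) * p t := by
      ext t
      rw [fourier_coe_apply, smul_eq_mul]
      simp
    rw [this, h, smul_zero]
  simp only [h2, norm_zero, ne_eq, OfNat.ofNat_ne_zero, not_false_eq_true, zero_pow, tsum_zero,
    sub_zero, inv_one, one_smul] at h1
  rw [intervalIntegral.integral_of_le zero_le_one] at h1
  have h3 := (integral_eq_zero_iff_of_nonneg (fun t => by positivity)
    ((memLp_two_iff_integrable_sq_norm hp.1).1 hp)).1 h1.symm
  filter_upwards [h3] with t ht
  simpa using ht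

section Edge

variable {a : ℝ} {p : ℝ → ℂ} {h : ℂ}

/-- Euler's formula `cos + i sin` for the two root solutions: this is where both spectra are
combined. -/
lemma potInt_add_mul_potInt (hp : IntervalIntegrable p volume 0 1) (ρ : ℂ) :
    potInt a p h 1 ρ + Complex.I * ρ * potInt a p h 0 ρ =
      ∫ t in (0 : ℝ)..1, psi h ρ (1 - t) * Complex.exp (Complex.I * ρ * (t - a + 1)) * p t := by
  have hi : ∀ ν, IntervalIntegrable (fun t => psi h ρ (1 - t) * phi ν ρ (t - a + 1) * p t)
      volume 0 1 := fun ν => hp.continuousOn_mul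
        (g := fun t => psi h ρ (1 - t) * phi ν ρ (t - a + 1)) (by fun_prop)
  rw [potInt, potInt, ← intervalIntegral.integral_const_mul,
    ← intervalIntegral.integral_add (hi 1) ((hi 0).const_mul _)]
  refine intervalIntegral.integral_congr fun t _ => ?_
  have e : Complex.exp (Complex.I * ρ * (t - a + 1)) =
      cosq ρ (t - a + 1) + Complex.I * (ρ * sinq ρ (t - a + 1)) := by
    rw [mul_sinq, cosq, show Complex.I * ρ * ((t : ℂ) - a + 1) =
      (ρ * ((t - a + 1 : ℝ) : ℂ)) * Complex.I by push_cast; ring, Complex.exp_mul_I]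
    ring
  simp only [phi, if_true, one_ne_zero, if_false]
  rw [e]; ring

/-- The quotient by `psi h ρ 1` is entire and bounded. At `ρ = iτ` its integrand is of size `exp (τ
(a - 1 - 2 t)) |p t|`, and the exponent is negative on the support of `p`, so the quotient tends to
zero by dominated convergence. -/
lemma potInt_add_mul_potInt_eq_zero (ha : 1 ≤ a) (hp : IntervalIntegrable p volume 0 1)
    (hp0 : ∀ᵐ x : ℝ, x ∈ Ioo 0 (a - 1) → p x = 0)
    (hO : ∀ z, (fun ρ => potInt a p h 1 ρ + Complex.I * ρ * potInt a p h 0 ρ) =O[𝓝 z]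
      fun ρ => psi h ρ 1) (ρ : ℂ) :
    potInt a p h 1 ρ + Complex.I * ρ * potInt a p h 0 ρ = 0 := by
  set N := (1 + ‖h‖) * ∫ t in (0 : ℝ)..1, ‖p t‖ with hN
  have hd0 := differentiable_potInt a hp h 0
  have hd1 := differentiable_potInt a hp h 1
  have hr1 : ∀ z : ℂ, max 1 (8 * ‖h‖) ≤ ‖z‖ → 1 ≤ ‖z‖ := fun z hz => (le_max_left _ _).trans hz
  have hr2 : ∀ z : ℂ, max 1 (8 * ‖h‖) ≤ ‖z‖ → 8 * ‖h‖ ≤ ‖z‖ := fun z hz =>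
    (le_max_right _ _).trans hz
  refine eq_zero_of_norm_le_on_farRegion
    (f := fun ρ => potInt a p h 1 ρ + Complex.I * ρ * potInt a p h 0 ρ) (g := fun ρ => psi h ρ 1)
    (r := max 1 (8 * ‖h‖)) (K := 16 * N) (by fun_prop) (by fun_prop) hO
    (fun z hz hr => psi_one_ne_zero hz (hr1 z hr) (hr2 z hr)) (fun z hz hr => ?_) ?_ ρ
  · have h1 := norm_potInt_le ha hp hp0 h 1 (hr1 z hr)
    have h0 := norm_potInt_le ha hp hp0 h 0 (hr1 z hr)
    have hl := le_norm_psi_one hz (hr1 z hr) (hr2 z hr)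
    have hz0 : 0 < ‖z‖ := one_pos.trans_le (hr1 z hr)
    have hN0 : 0 ≤ N := mul_nonneg (by positivity)
      (intervalIntegral.integral_nonneg zero_le_one fun t _ => norm_nonneg _)
    simp only [weight, one_ne_zero, if_false, one_mul, if_true] at h0 h1
    have h2 : ‖Complex.I * z * potInt a p h 0 z‖ ≤ Real.exp |z.im| * N := by
      rw [norm_mul, norm_mul, Complex.norm_I, one_mul]
      calc ‖z‖ * ‖potInt a p h 0 z‖ ≤ ‖z‖ * (‖z‖⁻¹ * Real.exp |z.im| * N) := by gcongr
        _ = _ := by field_simp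
    refine (norm_add_le _ _).trans ((add_le_add h1 h2).trans ?_)
    nlinarith
  · have hlim : Tendsto (fun τ : ℝ => ∫ t in (0 : ℝ)..1,
        (psi h (Complex.I * τ) (1 - t) * Complex.exp (Complex.I * (Complex.I * τ) * (t - a + 1)) *
          p t) / psi h (Complex.I * τ) 1) atTop (𝓝 (∫ t in (0 : ℝ)..1, (0 : ℂ))) := by
      have hτn : ∀ τ : ℝ, max 1 (8 * ‖h‖) ≤ τ → ‖Complex.I * (τ : ℂ)‖ = τ := fun τ hτ => by
        have : 0 ≤ τ := zero_le_one.trans ((le_max_left _ _).trans hτ)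
        simp [abs_of_nonneg this]
      have hbound : ∀ τ : ℝ, max 1 (8 * ‖h‖) ≤ τ → ∀ t : ℝ, t ∈ Ioc (0 : ℝ) 1 →
          ‖(psi h (Complex.I * τ) (1 - t) * Complex.exp (Complex.I * (Complex.I * τ) *
            (t - a + 1)) * p t) / psi h (Complex.I * τ) 1‖ ≤
            8 * (1 + ‖h‖) * ‖p t‖ * Real.exp (τ * (a - 1 - 2 * t)) := fun τ hτ t ht => by
        have hm := I_mul_mem_farRegion ((le_max_left _ _).trans hτ)
        have hτ' : max 1 (8 * ‖h‖) ≤ ‖Complex.I * (τ : ℂ)‖ := by rwa [hτn τ hτ]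
        have hl := le_norm_psi_one hm (hr1 _ hτ') (hr2 _ hτ')
        have hu := norm_psi_le h (hr1 _ hτ') (x := 1 - t) (by linarith [ht.2])
        have him : |(Complex.I * (τ : ℂ)).im| = τ := by
          have : 0 ≤ τ := zero_le_one.trans ((le_max_left _ _).trans hτ)
          simp [abs_of_nonneg this]
        rw [him] at hl hu
        have he : ‖Complex.exp (Complex.I * (Complex.I * τ) * (t - a + 1))‖ =
            Real.exp (-τ * (t - a + 1)) := by
          rw [Complex.norm_exp, ← mul_assoc, Complex.I_mul_I]
          congr 1
          rw [show (-1 : ℂ) * τ * (t - a + 1) = ((-τ * (t - a + 1) : ℝ) : ℂ) by push_cast; ring,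
            Complex.ofReal_re]
        rw [norm_div, norm_mul, norm_mul, he, div_le_iff₀
          ((by positivity : (0 : ℝ) < Real.exp τ / 8).trans_le hl)]
        calc ‖psi h (Complex.I * τ) (1 - t)‖ * Real.exp (-τ * (t - a + 1)) * ‖p t‖
            ≤ (1 + ‖h‖) * Real.exp (τ * (1 - t)) * Real.exp (-τ * (t - a + 1)) * ‖p t‖ := by
              gcongr
          _ = 8 * (1 + ‖h‖) * ‖p t‖ * Real.exp (τ * (a - 1 - 2 * t)) * (Real.exp τ / 8) := by
              have : Real.exp (τ * (1 - t)) * Real.exp (-τ * (t - a + 1)) =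
                  Real.exp (τ * (a - 1 - 2 * t)) * Real.exp τ := by
                rw [← Real.exp_add, ← Real.exp_add]; ring_nf
              rw [mul_assoc (1 + ‖h‖), this]; ring
          _ ≤ _ := by gcongr
      refine intervalIntegral.tendsto_integral_filter_of_dominated_convergence
        (fun t => 8 * (1 + ‖h‖) * ‖p t‖) (Eventually.of_forall fun τ => ?_) ?_
        (hp.norm.const_mul _) ?_
      · exact ((intervalIntegrable_iff.1 (hp.continuousOn_mul (g := fun t =>
          psi h (Complex.I * τ) (1 - t) * Complex.exp (Complex.I * (Complex.I * τ) *
            (t - a + 1))) (by fun_prop))).div_const _).aestronglyMeasurable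
      · filter_upwards [eventually_ge_atTop (max 1 (8 * ‖h‖))] with τ hτ
        filter_upwards [hp0] with t ht htI
        rw [uIoc_of_le zero_le_one] at htI
        by_cases hta : t < a - 1
        · simp [ht ⟨htI.1, hta⟩]
        · refine (hbound τ hτ t htI).trans (mul_le_of_le_one_right (by positivity) ?_)
          have : 0 ≤ τ := zero_le_one.trans ((le_max_left _ _).trans hτ)
          exact Real.exp_le_one_iff.2 (mul_nonpos_of_nonneg_of_nonpos this (by linarith))
      · filter_upwards [hp0] with t ht htI
        rw [uIoc_of_le zero_le_one] at htI
        by_cases hta : t < a - 1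
        · simp [ht ⟨htI.1, hta⟩]
        · refine squeeze_zero_norm' (a := fun τ : ℝ =>
            8 * (1 + ‖h‖) * ‖p t‖ * Real.exp (τ * (a - 1 - 2 * t))) ?_ ?_
          · filter_upwards [eventually_ge_atTop (max 1 (8 * ‖h‖))] with τ hτ
            exact hbound τ hτ t htI
          · have hneg : a - 1 - 2 * t < 0 := by linarith [htI.1]
            have := (Real.tendsto_exp_atBot.comp
              (tendsto_id.atTop_mul_const_of_neg hneg)).const_mul (8 * (1 + ‖h‖) * ‖p t‖)
            simpa using this
    rw [intervalIntegral.integral_zero] at hlim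
    refine hlim.congr fun τ => ?_
    rw [potInt_add_mul_potInt hp, intervalIntegral.integral_div]

/-- Once the combined integral vanishes, expanding `psi` in exponentials turns it into a relation
between the constant `J = ∫ p` and the transform `G`. Comparing growth on the negative imaginary
axis kills `J`, hence `G`, whose values at `π n` are the Fourier coefficients of `p`. -/
lemma ae_eq_zero_of_potInt_isBigO (ha : 1 ≤ a)
    (hp : MemLp p 2 (volume.restrict (Ioo (0 : ℝ) 1)))
    (hp0 : ∀ᵐ x : ℝ, x ∈ Ioo 0 (a - 1) → p x = 0)
    (hO : ∀ ν z, potInt a p h ν =O[𝓝 z] fun ρ => psi h ρ 1) :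
    p =ᵐ[volume.restrict (Ioo (0 : ℝ) 1)] 0 := by
  have hpi : IntervalIntegrable p volume 0 1 := by
    rw [intervalIntegrable_iff_integrableOn_Ioo_of_le zero_le_one]
    exact hp.integrable (by norm_num)
  have hF := potInt_add_mul_potInt_eq_zero ha hpi hp0 (h := h) fun z =>
    (hO 1 z).add (by
      have h1 : (fun ρ : ℂ => Complex.I * ρ) =O[𝓝 z] fun _ => (1 : ℂ) :=
        (by fun_prop : Continuous fun ρ : ℂ => Complex.I * ρ).continuousAt.tendsto.isBigO_one ℂ
      simpa using h1.mul (hO 0 z))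
  set J := ∫ t in (0 : ℝ)..1, p t with hJ
  set G : ℂ → ℂ := fun ρ => ∫ t in (0 : ℝ)..1, Complex.exp (2 * Complex.I * ρ * t) * p t with hG
  have hGd : Differentiable ℂ G := differentiable_integral_mul
    (K := fun ρ t => Complex.exp (2 * Complex.I * ρ * t)) (by fun_prop) (fun t => by fun_prop) hpi
  -- The factor `exp (iρ(a - 1))` cancels the delay: in `psi h ρ (1 - t) exp (iρt)` one exponential
  -- loses its dependence on `t` and the other becomes `exp (2iρt)`.
  have hrel : ∀ ρ : ℂ, (ρ - Complex.I * h) * Complex.exp (Complex.I * ρ) * J +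
      (ρ + Complex.I * h) * Complex.exp (-(Complex.I * ρ)) * G ρ = 0 := fun ρ => by
    have h1 := hF ρ
    rw [potInt_add_mul_potInt hpi] at h1
    have hGi : IntervalIntegrable (fun t : ℝ => Complex.exp (2 * Complex.I * ρ * t) * p t)
      volume 0 1 := hpi.continuousOn_mul
        (g := fun t : ℝ => Complex.exp (2 * Complex.I * ρ * t)) (by fun_prop)
    calc _ = ∫ t in (0 : ℝ)..1, (2 * ρ * Complex.exp (Complex.I * ρ * (a - 1))) *
          (psi h ρ (1 - t) * Complex.exp (Complex.I * ρ * (t - a + 1)) * p t) := by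
          rw [hJ, hG, ← intervalIntegral.integral_const_mul]
          simp only
          rw [← intervalIntegral.integral_const_mul,
            ← intervalIntegral.integral_add (hpi.const_mul _) (hGi.const_mul _)]
          refine intervalIntegral.integral_congr fun t _ => ?_
          have e1 : Complex.exp (Complex.I * ρ * (a - 1)) *
              Complex.exp (Complex.I * ρ * (t - a + 1)) = Complex.exp (Complex.I * ρ * t) := by
            rw [← Complex.exp_add]; ring_nf
          have e2 : Complex.exp (Complex.I * ρ) = Complex.exp (Complex.I * ρ * (1 - t)) *
              Complex.exp (Complex.I * ρ * t) := by
            rw [← Complex.exp_add]; ring_nf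
          have e3 : Complex.exp (-(Complex.I * ρ)) * Complex.exp (2 * Complex.I * ρ * t) =
              Complex.exp (-(Complex.I * ρ * (1 - t))) * Complex.exp (Complex.I * ρ * t) := by
            rw [← Complex.exp_add, ← Complex.exp_add]; ring_nf
          have e4 : 2 * ρ * psi h ρ (1 - t) =
              (ρ - Complex.I * h) * Complex.exp (Complex.I * ρ * (1 - t)) +
              (ρ + Complex.I * h) * Complex.exp (-(Complex.I * ρ * (1 - t))) := by
            have s1 := mul_sinq ρ (1 - t)
            have e5 : ρ * ((1 - t : ℝ) : ℂ) = ρ * (1 - t) := by push_cast; ring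
            have e6 : 2 * ρ * psi h ρ (1 - t) =
                2 * ρ * Complex.cos (ρ * (1 - t)) + 2 * h * Complex.sin (ρ * (1 - t)) := by
              rw [← e5, ← s1, psi, cosq]; ring
            rw [e6, Complex.cos, Complex.sin,
              show ρ * (1 - (t : ℂ)) * Complex.I = Complex.I * ρ * (1 - t) by ring,
              show -(ρ * (1 - (t : ℂ))) * Complex.I = -(Complex.I * ρ * (1 - t)) by ring]
            ring
          linear_combination (-2 * ρ * psi h ρ (1 - t) * p t) * e1 +
            (ρ - Complex.I * h) * p t * e2 + (ρ + Complex.I * h) * p t * e3 -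
            Complex.exp (Complex.I * ρ * t) * p t * e4
      _ = 0 := by rw [intervalIntegral.integral_const_mul, h1, mul_zero]
  -- At `ρ = -iτ` the relation reads `(τ + h) J = (h - τ) W`, where `W`, the rescaled value of `G`,
  -- tends to zero.
  have hJ0 : J = 0 := by
    have hW : Tendsto (fun τ : ℝ => ∫ t in (0 : ℝ)..1, Complex.exp (2 * τ * (t - 1)) * p t) atTop
        (𝓝 (∫ t in (0 : ℝ)..1, (0 : ℂ))) := by
      have hn : ∀ τ t : ℝ, ‖Complex.exp (2 * τ * (t - 1)) * p t‖ =
          ‖p t‖ * Real.exp (τ * (2 * (t - 1))) := fun τ t => by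
        rw [norm_mul, Complex.norm_exp, mul_comm,
          show (2 : ℂ) * τ * (t - 1) = ((τ * (2 * (t - 1)) : ℝ) : ℂ) by push_cast; ring,
          Complex.ofReal_re]
      refine intervalIntegral.tendsto_integral_filter_of_dominated_convergence (fun t => ‖p t‖)
        (Eventually.of_forall fun τ => ?_) ?_ hpi.norm ?_
      · exact (intervalIntegrable_iff.1 (hpi.continuousOn_mul
          (g := fun t : ℝ => Complex.exp (2 * τ * (t - 1))) (by fun_prop))).aestronglyMeasurable
      · filter_upwards [eventually_ge_atTop 0] with τ hτ
        refine Eventually.of_forall fun t ht => ?_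
        rw [uIoc_of_le zero_le_one] at ht
        rw [hn]
        refine mul_le_of_le_one_right (norm_nonneg _) (Real.exp_le_one_iff.2 ?_)
        exact mul_nonpos_of_nonneg_of_nonpos hτ (by linarith [ht.2])
      · filter_upwards [Measure.ae_ne volume (1 : ℝ)] with t ht htI
        rw [uIoc_of_le zero_le_one] at htI
        have hneg : 2 * (t - 1) < 0 := by linarith [lt_of_le_of_ne htI.2 ht]
        refine squeeze_zero_norm (fun τ => (hn τ t).le) ?_
        simpa using (Real.tendsto_exp_atBot.comp
          (tendsto_id.atTop_mul_const_of_neg hneg)).const_mul ‖p t‖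
    rw [intervalIntegral.integral_zero] at hW
    -- `τ ≥ 3 ‖h‖` gives `τ + ‖h‖ ≤ 2 (τ - ‖h‖)`, and the extra `1` makes `τ - ‖h‖` positive.
    have hle : ∀ τ : ℝ, 3 * ‖h‖ + 1 ≤ τ →
        ‖J‖ ≤ 2 * ‖∫ t in (0 : ℝ)..1, Complex.exp (2 * τ * (t - 1)) * p t‖ := fun τ hτ => by
      set W := ∫ t in (0 : ℝ)..1, Complex.exp (2 * τ * (t - 1)) * p t with hWdef
      have hGW : G (-(Complex.I * τ)) = Complex.exp (2 * τ) * W := by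
        rw [hG, hWdef, ← intervalIntegral.integral_const_mul]
        refine intervalIntegral.integral_congr fun t _ => ?_
        rw [← mul_assoc, ← Complex.exp_add]
        congr 2
        linear_combination (-2 * (τ : ℂ) * t) * Complex.I_mul_I
      have h1 := hrel (-(Complex.I * τ))
      have e1 : Complex.I * -(Complex.I * τ) = τ := by
        linear_combination (-(τ : ℂ)) * Complex.I_mul_I
      have e2 : Complex.exp (-(τ : ℂ)) * Complex.exp (2 * τ) = Complex.exp τ := by
        rw [← Complex.exp_add]; ring_nf
      rw [hGW, e1] at h1
      have h2 : (τ + h) * J = (h - τ) * W := by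
        have h3 : Complex.exp τ * Complex.I * ((τ + h) * J - (h - τ) * W) = 0 := by
          linear_combination -h1 + (-(Complex.I * τ) + Complex.I * h) * W * e2
        have h4 := (mul_eq_zero.1 h3).resolve_left
          (mul_ne_zero (Complex.exp_ne_zero _) Complex.I_ne_zero)
        exact sub_eq_zero.1 h4
      have hτ0 : 0 ≤ τ := by linarith [norm_nonneg h]
      have h5 : τ - ‖h‖ ≤ ‖(τ : ℂ) + h‖ := by
        have := norm_sub_le ((τ : ℂ) + h) h
        rw [add_sub_cancel_right, Complex.norm_of_nonneg hτ0] at this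
        linarith
      have h6 : ‖h - (τ : ℂ)‖ ≤ ‖h‖ + τ := by
        have := norm_sub_le h (τ : ℂ)
        rwa [Complex.norm_of_nonneg hτ0] at this
      have h7 : ‖(τ : ℂ) + h‖ * ‖J‖ = ‖h - (τ : ℂ)‖ * ‖W‖ := by
        rw [← norm_mul, h2, norm_mul]
      have h8 : (τ - ‖h‖) * ‖J‖ ≤ (‖h‖ + τ) * ‖W‖ :=
        (mul_le_mul_of_nonneg_right h5 (norm_nonneg _)).trans
          (h7.le.trans (mul_le_mul_of_nonneg_right h6 (norm_nonneg _)))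
      have h9 : (‖h‖ + τ) * ‖W‖ ≤ (τ - ‖h‖) * (2 * ‖W‖) := by nlinarith [norm_nonneg W]
      exact le_of_mul_le_mul_left (h8.trans h9) (by linarith [norm_nonneg h])
    refine norm_le_zero_iff.1 (ge_of_tendsto (by simpa using hW.norm.const_mul 2) ?_)
    filter_upwards [eventually_ge_atTop (3 * ‖h‖ + 1)] with τ hτ using hle τ hτ
  have hG0 : ∀ ρ, G ρ = 0 := by
    have h1 : ∀ ρ, ρ ≠ -(Complex.I * h) → G ρ = 0 := fun ρ hρ => by
      have := hrel ρ
      rw [hJ0, mul_zero, zero_add, mul_assoc, mul_eq_zero, mul_eq_zero] at this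
      rcases this with h2 | h2 | h2
      · exact absurd (eq_neg_of_add_eq_zero_left h2) hρ
      · exact absurd h2 (Complex.exp_ne_zero _)
      · exact h2
    intro ρ
    -- The relation says nothing about `G` at the zero of `ρ + ih`; continuity fills in that point.
    have hdense : Dense {z : ℂ | z ≠ -(Complex.I * h)} := dense_compl_singleton _
    exact congrFun (hGd.continuous.ext_on hdense continuous_const (fun z hz => h1 z hz)) ρ
  refine ae_eq_zero_of_integral_exp_eq_zero hp fun n => ?_
  have := hG0 (Real.pi * n)
  rw [hG] at this
  rw [← this]
  refine intervalIntegral.integral_congr fun t _ => ?_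
  congr 2
  ring

end Edge

/-! ### Separation of the edges and conclusion. -/

/-- A common zero for `h ≠ h'` would be a common zero of `sinq ρ 1` and `cosq ρ 1`, against the
Pythagorean identity. This is how the distinctness of the Robin coefficients enters. -/
lemma psi_one_ne_zero_of_ne {h h' ρ : ℂ} (hne : h ≠ h') (h0 : psi h ρ 1 = 0) :
    psi h' ρ 1 ≠ 0 := fun h1 => by
  unfold psi at h0 h1
  have h2 : (h - h') * sinq ρ 1 = 0 := by linear_combination h0 - h1
  have h3 := (mul_eq_zero.1 h2).resolve_left (sub_ne_zero.2 hne)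
  rw [h3, mul_zero, add_zero] at h0
  have := cosq_sq_add ρ 1
  rw [h0, h3] at this
  simp at this

section Main

variable {n : ℕ} {a : ℝ} {H : Fin n → ℂ} {q q' : GraphFun n}

lemma Admissible.intervalIntegrable (hq : Admissible a q) (j : Fin (n + 1)) :
    IntervalIntegrable (q j) volume 0 1 := by
  rw [intervalIntegrable_iff_integrableOn_Ioo_of_le zero_le_one]
  exact (hq.memLp j).integrable (by norm_num)

lemma Admissible.ae_eq_zero (hq : Admissible a q) (j : Fin n) :
    ∀ᵐ x : ℝ, x ∈ Ioo 0 (a - 1) → q j.succ x = 0 := by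
  filter_upwards [(ae_restrict_iff' measurableSet_Ioo).1 (hq.other_edges j)] with x hx h
  exact hx ⟨h.1, h.2.trans_le (le_max_right _ _)⟩

/-- The spectra counted with multiplicities determine the characteristic functions. -/
lemma charFn_eq_of_algMultiplicity_eq (hn : 1 ≤ n) (ha : 1 ≤ a) (hH : Function.Injective H)
    (hq : Admissible a q) (hq' : Admissible a q') (ν : Fin 2)
    (hspec : ∀ μ, algMultiplicity a q H ν μ = algMultiplicity a q' H ν μ) (ρ : ℂ) :
    charFn a q H ν ρ = charFn a q' H ν ρ := by
  have key : ∀ {q : GraphFun n}, Admissible a q → ∀ (z : ℂ) (j₀ : Fin n),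
      (∀ k ≠ j₀, psi (H k) z 1 ≠ 0) → ∃ p : ℕ, algMultiplicity a q H ν (z ^ 2) = p ∧
        charFn a q H ν =Θ[𝓝 z] fun ρ => (ρ ^ 2 - z ^ 2) ^ p := fun {q} hq z j₀ hj₀ => by
    have hd := differentiable_charFn a (fun j : Fin n => hq.intervalIntegrable j.succ) H ν
    obtain ⟨r, hr1, hrH, hlow⟩ := exists_le_norm_charFn (H := H) hn ha
      (fun j : Fin n => hq.intervalIntegrable j.succ) hq.ae_eq_zero ν
    have hm := I_mul_mem_farRegion hr1
    have hr : r ≤ ‖Complex.I * (r : ℂ)‖ := by simpa using le_abs_self r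
    -- The lower bound at one point of the imaginary axis shows that `charFn` is not identically
    -- zero.
    have hne : charFn a q H ν (Complex.I * r) ≠ 0 := by
      have h1 : 0 < ‖∏ k, psi (H k) (Complex.I * r) 1‖ :=
        norm_pos_iff.2 (Finset.prod_ne_zero_iff.2 fun k _ =>
          psi_one_ne_zero hm (hr1.trans hr) ((hrH k).trans hr))
      have h2 := weight_pos ν (hr1.trans hr)
      have h3 : 0 < ‖Complex.I * (r : ℂ)‖ := by linarith
      exact norm_pos_iff.1 (lt_of_lt_of_le (by positivity) (hlow _ hm hr))
    exact exists_algMultiplicity_eq_and_isTheta ha (fun j => hq.intervalIntegrable j.succ)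
      hq.ae_eq_zero hj₀ (hd.analyticAt z) (not_eventually_eq_zero hd hne z)
  refine charFn_eq_of_isBigO hn ha (fun j => hq.intervalIntegrable j.succ) hq.ae_eq_zero
    (fun j => hq'.intervalIntegrable j.succ) hq'.ae_eq_zero ν (fun z => ?_) ρ
  -- The edge to relax is the only one whose `psi` vanishes at `z`, or an arbitrary one if none
  -- does.
  obtain ⟨j₀, hj₀⟩ : ∃ j₀ : Fin n, ∀ k ≠ j₀, psi (H k) z 1 ≠ 0 := by
    by_cases h : ∃ j, psi (H j) z 1 = 0
    · obtain ⟨j, hj⟩ := h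
      exact ⟨j, fun k hk => psi_one_ne_zero_of_ne (fun e => hk (hH e).symm) hj⟩
    · exact ⟨⟨0, hn⟩, fun k _ hk => h ⟨k, hk⟩⟩
  obtain ⟨p, hp, hΘ⟩ := key hq z j₀ hj₀
  obtain ⟨p', hp', hΘ'⟩ := key hq' z j₀ hj₀
  have hpp : p = p' := by
    have := hspec (z ^ 2)
    rw [hp, hp'] at this
    exact_mod_cast this
  subst hpp
  exact (hΘ.trans hΘ'.symm).isBigO

/-- In the vanishing sum `charFn - charFn'` every term except the `j`-th contains the factor `psi (H
j)`, while the cofactor of the `j`-th term is nonzero at the zeros of `psi (H j)`. Hence the `j`-th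
difference is locally divisible by `psi (H j)`. -/
lemma potInt_sub_isBigO (hH : Function.Injective H)
    (hq : ∀ j : Fin n, IntervalIntegrable (q j.succ) volume 0 1)
    (hq' : ∀ j : Fin n, IntervalIntegrable (q' j.succ) volume 0 1) {ν : Fin 2}
    (h : ∀ ρ, charFn a q H ν ρ = charFn a q' H ν ρ) (j : Fin n) (z : ℂ) :
    (fun ρ => potInt a (q j.succ) (H j) ν ρ - potInt a (q' j.succ) (H j) ν ρ) =O[𝓝 z]
      fun ρ => psi (H j) ρ 1 := by
  set Q : Fin n → ℂ → ℂ := fun j ρ =>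
    potInt a (q j.succ) (H j) ν ρ - potInt a (q' j.succ) (H j) ν ρ with hQ
  have hQc : ∀ j, Continuous (Q j) := fun j => ((differentiable_potInt a (hq j) (H j) ν).sub
    (differentiable_potInt a (hq' j) (H j) ν)).continuous
  have C1 : ∀ {g : ℂ → ℂ}, ContinuousAt g z → g =O[𝓝 z] fun _ => (1 : ℂ) := fun hg =>
    hg.tendsto.isBigO_one ℂ
  change Q j =O[𝓝 z] _
  by_cases h0 : psi (H j) z 1 = 0
  · set P : ℂ → ℂ := fun ρ => ∏ k ∈ Finset.univ.erase j, psi (H k) ρ 1 with hP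
    have hPc : Continuous P := by fun_prop
    have hP0 : P z ≠ 0 := Finset.prod_ne_zero_iff.2 fun k hk =>
      psi_one_ne_zero_of_ne (fun e => Finset.ne_of_mem_erase hk (hH e).symm) h0
    set S : ℂ → ℂ := fun ρ => ∑ l ∈ Finset.univ.erase j,
      Q l ρ * ∏ k ∈ (Finset.univ.erase l).erase j, psi (H k) ρ 1 with hS
    have hSc : Continuous S := by fun_prop
    have hrel : ∀ ρ, Q j ρ * P ρ = psi (H j) ρ 1 * -S ρ := fun ρ => by
      have h1 := sub_eq_zero.2 (h ρ)
      rw [charFn_sub_charFn, ← Finset.add_sum_erase _ _ (Finset.mem_univ j)] at h1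
      rw [mul_neg, hS, Finset.mul_sum]
      refine eq_neg_of_add_eq_zero_left ?_
      rw [← h1]
      congr 1
      refine Finset.sum_congr rfl fun l hl => ?_
      rw [← Finset.mul_prod_erase (Finset.univ.erase l) (fun k => psi (H k) ρ 1) (a := j)
        (Finset.mem_erase.2 ⟨(Finset.ne_of_mem_erase hl).symm, Finset.mem_univ j⟩)]
      ring
    have h2 : (fun ρ => psi (H j) ρ 1 * (-S ρ * (P ρ)⁻¹)) =O[𝓝 z] fun ρ => psi (H j) ρ 1 := by
      simpa using (isBigO_refl (fun ρ => psi (H j) ρ 1) (𝓝 z)).mul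
        (C1 (g := fun ρ => -S ρ * (P ρ)⁻¹) (hSc.neg.continuousAt.mul (hPc.continuousAt.inv₀ hP0)))
    refine h2.congr' ?_ EventuallyEq.rfl
    filter_upwards [hPc.continuousAt.eventually_ne hP0] with ρ hρ
    rw [← mul_assoc, ← hrel]
    field_simp
  · have hpc : Continuous fun ρ => psi (H j) ρ 1 := by fun_prop
    have h2 : (fun ρ => psi (H j) ρ 1 * (Q j ρ * (psi (H j) ρ 1)⁻¹)) =O[𝓝 z]
        fun ρ => psi (H j) ρ 1 := by
      simpa using (isBigO_refl (fun ρ => psi (H j) ρ 1) (𝓝 z)).mul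
        (C1 (g := fun ρ => Q j ρ * (psi (H j) ρ 1)⁻¹)
          ((hQc j).continuousAt.mul (hpc.continuousAt.inv₀ h0)))
    refine h2.congr' ?_ EventuallyEq.rfl
    filter_upwards [hpc.continuousAt.eventually_ne h0] with ρ hρ
    field_simp

lemma potInt_sub {q q' : ℝ → ℂ} (hq : IntervalIntegrable q volume 0 1)
    (hq' : IntervalIntegrable q' volume 0 1) (h : ℂ) (ν : Fin 2) (ρ : ℂ) :
    potInt a (q - q') h ν ρ = potInt a q h ν ρ - potInt a q' h ν ρ := by
  have hi : ∀ {q : ℝ → ℂ}, IntervalIntegrable q volume 0 1 → IntervalIntegrable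
      (fun t => psi h ρ (1 - t) * phi ν ρ (t - a + 1) * q t) volume 0 1 := fun hq =>
    hq.continuousOn_mul (g := fun t => psi h ρ (1 - t) * phi ν ρ (t - a + 1)) (by fun_prop)
  rw [potInt, potInt, potInt, ← intervalIntegral.integral_sub (hi hq) (hi hq')]
  exact intervalIntegral.integral_congr fun t _ => mul_sub _ _ _

end Main

end StarDelay

end

theorem theorem1 {n : ℕ} (a : ℝ) (ha : a ∈ Set.Ico (1 : ℝ) 2)
    (H : Fin n → ℂ) (hH : Function.Injective H)
    (q q' : StarDelay.GraphFun n)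
    (hq : StarDelay.Admissible a q) (hq' : StarDelay.Admissible a q')
    (hspec : ∀ (ν : Fin 2) (μ : ℂ),
      StarDelay.algMultiplicity a q H ν μ = StarDelay.algMultiplicity a q' H ν μ) :
    ∀ j : Fin n, q j.succ =ᵐ[MeasureTheory.volume.restrict (Set.Ioo (0 : ℝ) 1)] q' j.succ := by
  intro j
  have hn : 1 ≤ n := Nat.one_le_iff_ne_zero.2 fun h => by subst h; exact j.elim0
  have h1 : ∀ j : Fin n, IntervalIntegrable (q j.succ) MeasureTheory.volume 0 1 :=
    fun j => hq.intervalIntegrable j.succ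
  have h1' : ∀ j : Fin n, IntervalIntegrable (q' j.succ) MeasureTheory.volume 0 1 :=
    fun j => hq'.intervalIntegrable j.succ
  -- `potInt` is linear in the potential, so the one-edge theorem applies to the difference `q -
  -- q'`.
  have h2 := StarDelay.ae_eq_zero_of_potInt_isBigO (a := a) (p := q j.succ - q' j.succ) (h := H j)
    ha.1 ((hq.memLp j.succ).sub (hq'.memLp j.succ))
    (by
      filter_upwards [hq.ae_eq_zero j, hq'.ae_eq_zero j] with x hx hx' h
      simp [hx h, hx' h])
    (fun ν z => (StarDelay.potInt_sub_isBigO hH h1 h1'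
      (StarDelay.charFn_eq_of_algMultiplicity_eq hn ha.1 hH hq hq' ν (hspec ν)) j z).congr_left
        fun ρ => (StarDelay.potInt_sub (h1 j) (h1' j) (H j) ν ρ).symm)
  filter_upwards [h2] with x hx
  simpa [sub_eq_zero] using hx
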